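/- Let $K$ be a number field with ring of integers $\mathcal{O}_K$. For $f\in\mathcal{O}_K[x]$ write $f^n$ for the $n$-fold composition of $f$ with itself. A critical point of $f$ is a root of $f'$ in an algebraic closure $\overline{K}$. Definitions. "Prime" means non-zero prime ideal of $\mathcal{O}_K$; $k_{\mathfrak p}=\mathcal{O}_K/\mathfrak p$. * A set $S\subseteq\mathcal{O}_K$ has density $\delta$ if the proportion of elements of $S$ among the finitely many $a\in\mathcal{O}_K$ with $\max_{\sigma:K\hookrightarrow\mathbb{C}}|\sigma(a)|\le B$ tends to $\delta$ as $B\to\infty$. * $g\in\mathcal{O}_K[x]$ is monogenic if it is irreducible over $K$ and $\mathcal{O}_K[\alpha]=\mathcal{O}_{K(\alpha)}$ for its roots $\alpha$. It is $\mathfrak p$-maximal if it is irreducible over $K$ and, for its roots $\alpha$, $\mathcal{O}_K[\alpha]$ and $\mathcal{O}_{K(\alpha)}$ have the same localization at $\mathfrak p$. (Polynomials to which these notions are applied below have unit leading coefficient.) * $(f,a)$, with $a\in\mathcal{O}_K$, is dynamically irreducible (resp. dynamically monogenic) if $f^n(x)-a$ is irreducible over $K$ (resp. monogenic) for all $n\ge1$.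 * $\mathfrak p$ is a vanishing prime for $f$ if $f'\equiv0\bmod\mathfrak p$, and a non-vanishing prime otherwise. A non-vanishing prime $\mathfrak p$ is non-exceptional for $f$ if for all $a\in\mathcal{O}_K$, every irreducible factor $h$ of $f'$ in $K[x]$ (scaled so as to lie in $\mathcal{O}_K[x]$ and to have non-zero reduction mod $\mathfrak p$), every irreducible factor $\phi$ of $h$ in $k_{\mathfrak p}[x]$ and every $n\ge1$: if the multiplicity $v_\phi(f^n(x)-a)$ of $\phi$ in $f^n(x)-a\bmod\mathfrak p$ is positive, then $v_\phi(f^n(x)-a)>v_\phi(h)$. Otherwise it is exceptional. Lemma. Let $f\in\mathcal{O}_K[x]$ be a post-critically finite polynomial (every critical point has a finite forward orbit) whose leading coefficient is a unit and all of whose critical values $f(\theta)$, $\theta$ a critical point, lie in $K$. Let $\Omega\subset K$ be the finite set of all $f^n(\theta)$ with $\theta$ a critical point and $n\ge1$. Assume that $(f,a)$ is dynamically irreducible for all $a\in\mathcal{O}_K$ outside a set of density $0$, and that no non-vanishing prime is exceptional for $f$. Then the following are equivalent: 1. Both of the following hold: (i) for every non-vanishing prime $\mathfrak p$, some residue class modulo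 $\mathfrak p^2$ contains no element of $\Omega$; (ii) for every vanishing prime $\mathfrak p$, there is some $a\in\mathcal{O}_K$ such that $f(x)-a$ is $\mathfrak p$-maximal. 2. There is a set $S\subseteq\mathcal{O}_K$ that has a positive density such that $(f,a)$ is dynamically monogenic for every $a\in S$. -/

import Mathlib

open Polynomial NumberField IsDedekindDomain

namespace DynMono

/-- The `n`-fold composition `fⁿ` of `f` with itself (`f⁰ = X`). -/
noncomputable def iter {R : Type*} [CommRing R] (f : R[X]) (n : ℕ) : R[X] :=
  f.comp^[n] X

section Density

/-- The set `S` of algebraic integers of `K` has (natural, relative) density `δ`: among the finitely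
many `a ∈ 𝓞 K` with `max_σ |σ(a)| ≤ B`, where `σ` runs over the complex embeddings of `K`, the
proportion of those lying in `S` tends to `δ` as `B → ∞`. -/
def HasDensity {K : Type*} [Field K] [NumberField K] (S : Set (𝓞 K)) (δ : ℝ) : Prop :=
  Filter.Tendsto
    (fun B : ℝ => ({a : 𝓞 K | a ∈ S ∧ house (a : K) ≤ B}.ncard : ℝ) /
      ({a : 𝓞 K | house (a : K) ≤ B}.ncard : ℝ))
    Filter.atTop (nhds δ)

end Density

section Critical

/-- `θ` is a critical point of `f`, i.e. a root of `f'` in an algebraic closure of `K`. -/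
def IsCriticalPoint {K : Type*} [Field K] [NumberField K] (f : (𝓞 K)[X])
    (θ : AlgebraicClosure K) : Prop :=
  aeval θ (derivative f) = 0

/-- `f` is post-critically finite: the forward orbit of every critical point is finite. -/
def IsPCF {K : Type*} [Field K] [NumberField K] (f : (𝓞 K)[X]) : Prop :=
  ∀ θ : AlgebraicClosure K, IsCriticalPoint f θ →
    (Set.range fun n : ℕ => aeval θ (iter f n)).Finite

/-- All critical values `f(θ)` of `f` lie in `K`. -/
def HasRationalCriticalValues {K : Type*} [Field K] [NumberField K] (f : (𝓞 K)[X]) : Prop :=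
  ∀ θ : AlgebraicClosure K, IsCriticalPoint f θ →
    ∃ c : K, algebraMap K (AlgebraicClosure K) c = aeval θ f

/-- The set `Ω` of all `fⁿ(θ) ∈ K` with `θ` a critical point of `f` and `n ≥ 1`. If the critical
values of `f` are `K`-rational, then so are all these iterates. -/
def postcriticalSet {K : Type*} [Field K] [NumberField K] (f : (𝓞 K)[X]) : Set K :=
  {c | ∃ θ : AlgebraicClosure K, IsCriticalPoint f θ ∧
    ∃ n : ℕ, 1 ≤ n ∧ algebraMap K (AlgebraicClosure K) c = aeval θ (iter f n)}

end Critical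

section Primes

/-- The reduction of `g` modulo the prime `𝔭`, a polynomial over the residue field. -/
noncomputable def red {K : Type*} [Field K] [NumberField K] (p : HeightOneSpectrum (𝓞 K))
    (g : (𝓞 K)[X]) : (𝓞 K ⧸ p.asIdeal)[X] :=
  g.map (Ideal.Quotient.mk p.asIdeal)

/-- `𝔭` is a vanishing prime for `f`: `f' ≡ 0 mod 𝔭`. -/
def IsVanishing {K : Type*} [Field K] [NumberField K] (f : (𝓞 K)[X])
    (p : HeightOneSpectrum (𝓞 K)) : Prop :=
  red p (derivative f) = 0

/-- `𝔭` is non-exceptional for the pair `(f, a)`: `f' ≢ 0 mod 𝔭` and, for every irreducible factor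
`h` of `f'` in `K[x]`, every irreducible factor `φ` of `h` in `k_𝔭[x]` and every `n ≥ 1`,
`v_φ(fⁿ - a) > 0` implies `v_φ(fⁿ - a) > v_φ(h)`. An irreducible factor `h` of `f'` is determined up
to a constant of `Kˣ`; in order to reduce it modulo `𝔭`, it is scaled to have coefficients in `𝓞 K`
and non-zero reduction modulo `𝔭`. This is always possible, and any two such choices have the same
reduction up to a non-zero constant. -/
def IsNonExceptionalFor {K : Type*} [Field K] [NumberField K] (f : (𝓞 K)[X]) (a : 𝓞 K)
    (p : HeightOneSpectrum (𝓞 K)) : Prop :=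
  ¬ IsVanishing f p ∧
    ∀ h : (𝓞 K)[X], Irreducible (h.map (algebraMap (𝓞 K) K)) →
      h.map (algebraMap (𝓞 K) K) ∣ (derivative f).map (algebraMap (𝓞 K) K) →
      red p h ≠ 0 →
      ∀ φ : (𝓞 K ⧸ p.asIdeal)[X], Irreducible φ → φ ∣ red p h →
      ∀ n : ℕ, 1 ≤ n → 0 < emultiplicity φ (red p (iter f n - C a)) →
        emultiplicity φ (red p h) < emultiplicity φ (red p (iter f n - C a))

/-- `𝔭` is exceptional for `f`: it is not the case that it is non-exceptional for all pairs
`(f, a)`. -/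
def IsExceptional {K : Type*} [Field K] [NumberField K] (f : (𝓞 K)[X])
    (p : HeightOneSpectrum (𝓞 K)) : Prop :=
  ¬ ∀ a : 𝓞 K, IsNonExceptionalFor f a p

end Primes

section Monogenic

/-- The ring of integers of `K(α)`, as an `𝓞 K`-subalgebra of the algebraic closure of `K`. -/
noncomputable def integersAdjoin {K : Type*} [Field K] [NumberField K] (α : AlgebraicClosure K) :
    Subalgebra (𝓞 K) (AlgebraicClosure K) :=
  integralClosure (𝓞 K) (AlgebraicClosure K) ⊓
    (IntermediateField.adjoin K {α}).toSubalgebra.restrictScalars (𝓞 K)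

/-- `g` is monogenic: it is irreducible over `K` and `𝓞_K[α] = 𝓞_{K(α)}` for its roots `α`. -/
def IsMonogenic {K : Type*} [Field K] [NumberField K] (g : (𝓞 K)[X]) : Prop :=
  Irreducible (g.map (algebraMap (𝓞 K) K)) ∧
    ∀ α : AlgebraicClosure K, aeval α g = 0 →
      Algebra.adjoin (𝓞 K) {α} = integersAdjoin α

/-- `g` is `𝔭`-maximal: it is irreducible over `K` and, for its roots `α`, the rings `𝓞_K[α]` and
`𝓞_{K(α)}` have the same localization at `𝔭`. -/
def IsMaximalAt {K : Type*} [Field K] [NumberField K] (p : HeightOneSpectrum (𝓞 K))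
    (g : (𝓞 K)[X]) : Prop :=
  Irreducible (g.map (algebraMap (𝓞 K) K)) ∧
    ∀ α : AlgebraicClosure K, aeval α g = 0 →
      Submodule.localized p.asIdeal.primeCompl (Subalgebra.toSubmodule (Algebra.adjoin (𝓞 K) {α})) =
        Submodule.localized p.asIdeal.primeCompl (Subalgebra.toSubmodule (integersAdjoin α))

/-- `(f, a)` is dynamically irreducible: `fⁿ - a` is irreducible over `K` for all `n ≥ 1`. -/
def IsDynIrreducible {K : Type*} [Field K] [NumberField K] (f : (𝓞 K)[X]) (a : 𝓞 K) : Prop :=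
  ∀ n : ℕ, 1 ≤ n → Irreducible ((iter f n - C a).map (algebraMap (𝓞 K) K))

/-- `(f, a)` is dynamically monogenic: `fⁿ - a` is monogenic for all `n ≥ 1`. -/
def IsDynMonogenic {K : Type*} [Field K] [NumberField K] (f : (𝓞 K)[X]) (a : 𝓞 K) : Prop :=
  ∀ n : ℕ, 1 ≤ n → IsMonogenic (iter f n - C a)

end Monogenic

end DynMono

/-! Let `g` have unit leading coefficient, be irreducible over `K` and have the root `α`. Then
𝓞_K[α] is 𝓞_K[X]/(g), and 𝓞_K[X] is regular of dimension two. So the quotient is integrally closed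
at the image of a maximal ideal `M` containing `g` exactly when `g ∉ M ^ 2`. This form of Dedekind's
criterion (`isMonogenic_of_forall_notMem_sq`, `IsMaximalAt.notMem_sq`) reduces the problem to
deciding when `fⁿ - a ∈ M ^ 2` for some `M` above `p`.

Let `p` be non-vanishing. If `fⁿ - a ∈ M ^ 2`, then `(fⁿ)' ∈ M`, and the chain rule yields a
critical point `θ` with minimal polynomial `h` such that `h ∘ fⁱ ∈ M`. As `h ^ 2` divides `fᵏ - b`
for `b = fᵏ(θ)`, with `k = n - i`, also `fⁿ - b ∈ M ^ 2`. Hence `a - b` lies in `M ^ 2 ∩ 𝓞_K = p ^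
2`: the class of `a` modulo `p ^ 2` meets `Ω`. Conversely, if `a ≡ fᵏ(θ)` modulo `p ^ 2`, then `fᵏ -
a` lies in the square of any maximal ideal containing `p` and `h`.

Let `p` be vanishing. Then `f - a` is an `ℓ`-th power modulo `p`, with `ℓ` the residue
characteristic, and writing it out modulo `p ^ 2` shows that an obstruction for `(f - a) ∘ s`
already is one for `f - a`. So `p`-maximality of `f - a` passes to all iterates and depends only on
`a` modulo `p ^ 2`.

It remains to sieve. One prescribes the class of `a` modulo `p ^ 2` at the finitely many vanishing
primes and avoids the finite set `Ω` modulo `p ^ 2` at all others. As the sum of `N(p) ^ (-2)`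
converges and some class is free at each prime, the surviving set has a positive density
(`exists_hasDensity_sieve`). In the other direction a single dynamically monogenic `(f, a)` gives
all the local conditions. -/

namespace DynMono

open Filter Topology Pointwise

/-! ### Counting algebraic integers of bounded house -/

section LatticePoints

variable (K : Type*) [Field K] [NumberField K]

/-- The real coordinates of an algebraic integer in the integral basis. -/
noncomputable def coords (a : 𝓞 K) : Module.Free.ChooseBasisIndex ℤ (𝓞 K) → ℝ :=
  fun i => ((RingOfIntegers.basis K).repr a i : ℝ)

/-- The real-linear extension of the canonical embedding to the coordinate space. -/
noncomputable def coordsEmbedding :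
    (Module.Free.ChooseBasisIndex ℤ (𝓞 K) → ℝ) →ₗ[ℝ] ((K →+* ℂ) → ℂ) :=
  Fintype.linearCombination ℝ (fun i => canonicalEmbedding K (integralBasis K i))

theorem coordsEmbedding_injective : Function.Injective (coordsEmbedding K) := by
  have h : LinearIndependent ℝ (fun i => canonicalEmbedding K (integralBasis K i)) := by
    have h1 := (canonicalEmbedding.latticeBasis K).linearIndependent
    have h2 : (canonicalEmbedding.latticeBasis K : _ → (K →+* ℂ) → ℂ) =
        fun i => canonicalEmbedding K (integralBasis K i) := by
      funext i; exact canonicalEmbedding.latticeBasis_apply K i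
    rw [h2] at h1
    exact h1.restrict_scalars' ℝ
  exact h.fintypeLinearCombination_injective

theorem coordsEmbedding_coords (a : 𝓞 K) :
    coordsEmbedding K (coords K a) = canonicalEmbedding K (a : K) := by
  have h := congrArg (algebraMap (𝓞 K) K) ((RingOfIntegers.basis K).sum_repr a)
  rw [map_sum] at h
  rw [coordsEmbedding, Fintype.linearCombination_apply]
  conv_rhs => rw [show (a : K) = algebraMap (𝓞 K) K a from rfl, ← h, map_sum]
  refine Finset.sum_congr rfl fun i _ => ?_
  rw [integralBasis_apply, zsmul_eq_mul, map_mul, map_mul, map_intCast, map_intCast, coords]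
  funext σ
  simp

theorem coords_injective : Function.Injective (coords K) := by
  intro a b h
  apply (RingOfIntegers.basis K).repr.injective
  ext i
  have := congrFun h i
  simpa [coords] using this

/-- Puts 𝓞_K in the shape of the standard lattice, as needed for counting lattice points by volume.
-/
theorem range_coords : Set.range (coords K) =
    (Submodule.span ℤ (Set.range (Pi.basisFun ℝ (Module.Free.ChooseBasisIndex ℤ (𝓞 K)))) :
      Set (Module.Free.ChooseBasisIndex ℤ (𝓞 K) → ℝ)) := by
  ext x
  rw [SetLike.mem_coe, Module.Basis.mem_span_iff_repr_mem]
  constructor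
  · rintro ⟨a, rfl⟩ i
    exact ⟨(RingOfIntegers.basis K).repr a i, by simp [coords]⟩
  · intro h
    choose c hc using h
    refine ⟨(RingOfIntegers.basis K).equivFun.symm c, ?_⟩
    funext i
    have := hc i
    simp only [Pi.basisFun_repr, eq_intCast] at this
    rw [coords, ← this, ← Module.Basis.equivFun_apply, LinearEquiv.apply_symm_apply]

theorem house_eq_norm_coordsEmbedding (a : 𝓞 K) :
    house (a : K) = ‖coordsEmbedding K (coords K a)‖ := by
  rw [coordsEmbedding_coords]; rfl

open MeasureTheory in
/-- The number of algebraic integers of house at most `B` grows like `κ B ^ [K : ℚ]`. -/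
theorem exists_tendsto_ncard_house_le :
    ∃ κ : ℝ, 0 < κ ∧ Tendsto (fun B : ℝ =>
      ({a : 𝓞 K | house (a : K) ≤ B}.ncard : ℝ) / B ^ Module.finrank ℚ K) atTop (𝓝 κ) := by
  set T := coordsEmbedding K with hT
  have hcont : Continuous T := T.continuous_of_finiteDimensional
  set s : Set (Module.Free.ChooseBasisIndex ℤ (𝓞 K) → ℝ) := T ⁻¹' Metric.closedBall 0 1 with hs
  have hmem : ∀ x, x ∈ s ↔ ‖T x‖ ≤ 1 := fun x => by simp [hs]
  have hconv : Convex ℝ s := (convex_closedBall 0 1).linear_preimage T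
  have hclosed : IsClosed s := Metric.isClosed_closedBall.preimage hcont
  have hbdd : Bornology.IsBounded s := by
    obtain ⟨c, _, hc⟩ := LinearMap.exists_antilipschitzWith T
      (LinearMap.ker_eq_bot.mpr (coordsEmbedding_injective K))
    exact hc.isBounded_preimage Metric.isBounded_closedBall
  have hint : s ∈ 𝓝 (0 : Module.Free.ChooseBasisIndex ℤ (𝓞 K) → ℝ) := by
    apply hcont.continuousAt.preimage_mem_nhds
    rw [map_zero]
    exact Metric.closedBall_mem_nhds _ one_pos
  have hcard : Fintype.card (Module.Free.ChooseBasisIndex ℤ (𝓞 K)) = Module.finrank ℚ K := by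
    rw [← Module.finrank_eq_card_chooseBasisIndex, RingOfIntegers.rank]
  refine ⟨volume.real s, ?_, ?_⟩
  · exact ENNReal.toReal_pos (Measure.measure_pos_of_mem_nhds _ hint).ne'
      hbdd.measure_lt_top.ne
  -- The body is convex, so its frontier is null; it is stable under scaling by factors in [0, 1],
  -- so its dilates are nested and the limit may be taken over real `B`.
  · have key := tendsto_card_div_pow_atTop_volume' s hbdd hclosed.measurableSet
      (hconv.addHaar_frontier volume) (fun x y hx hxy => by
        rintro _ ⟨z, hz, rfl⟩
        have hy : 0 < y := hx.trans_le hxy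
        refine ⟨(x / y) • z, ?_, ?_⟩
        · rw [hmem] at hz ⊢
          rw [map_smul, norm_smul, Real.norm_of_nonneg (by positivity)]
          have : x / y ≤ 1 := (div_le_one hy).mpr hxy
          have h0 : 0 ≤ x / y := by positivity
          nlinarith [norm_nonneg (T z)]
        · simp only [smul_smul]
          congr 1
          field_simp)
    rw [hcard] at key
    refine key.congr' ?_
    filter_upwards [eventually_gt_atTop 0] with B hB
    congr 2
    rw [Nat.card_coe_set_eq]
    have : s ∩ B⁻¹ • (Submodule.span ℤ
        (Set.range (Pi.basisFun ℝ (Module.Free.ChooseBasisIndex ℤ (𝓞 K)))) :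
          Set (Module.Free.ChooseBasisIndex ℤ (𝓞 K) → ℝ)) =
        (fun a => B⁻¹ • coords K a) '' {a : 𝓞 K | house (a : K) ≤ B} := by
      rw [← range_coords]
      ext x
      constructor
      · rintro ⟨hx, _, ⟨a, rfl⟩, rfl⟩
        refine ⟨a, ?_, rfl⟩
        rw [hmem] at hx
        simp only [map_smul, norm_smul, norm_inv, Real.norm_of_nonneg hB.le] at hx
        rw [Set.mem_ofPred_eq, house_eq_norm_coordsEmbedding]
        rwa [inv_mul_le_iff₀ hB, mul_one] at hx
      · rintro ⟨a, ha, rfl⟩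
        refine ⟨?_, Set.smul_mem_smul_set ⟨a, rfl⟩⟩
        rw [Set.mem_ofPred_eq, house_eq_norm_coordsEmbedding] at ha
        rw [hmem]
        simp only [map_smul, norm_smul, norm_inv, Real.norm_of_nonneg hB.le]
        rwa [inv_mul_le_iff₀ hB, mul_one]
    rw [this, Set.ncard_image_of_injective]
    exact (smul_right_injective _ (inv_ne_zero hB.ne')).comp (coords_injective K)

theorem finite_house_le (B : ℝ) : {a : 𝓞 K | house (a : K) ≤ B}.Finite := by
  have h := Embeddings.finite_of_norm_le K ℂ B
  refine Set.Finite.of_finite_image (f := fun a : 𝓞 K => (a : K)) (h.subset ?_)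
    RingOfIntegers.coe_injective.injOn
  rintro _ ⟨a, ha, rfl⟩
  refine ⟨RingOfIntegers.isIntegral_coe a, fun φ => ?_⟩
  exact (norm_le_pi_norm (canonicalEmbedding K (a : K)) φ).trans ha

end LatticePoints

end DynMono

namespace DynMono

open Filter Topology Pointwise

/-! ### Estimates for box counts -/

section Counting

variable (K : Type*) [Field K] [NumberField K]

/-- The number of algebraic integers of house at most `B`. -/
noncomputable def boxCard (B : ℝ) : ℝ := ({a : 𝓞 K | house (a : K) ≤ B}.ncard : ℝ)

variable {K}

/-- The number of elements of `T` of house at most `B`. -/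
noncomputable def boxCardIn (T : Set (𝓞 K)) (B : ℝ) : ℝ :=
  ({a : 𝓞 K | a ∈ T ∧ house (a : K) ≤ B}.ncard : ℝ)

theorem finite_mem_house_le (T : Set (𝓞 K)) (B : ℝ) :
    {a : 𝓞 K | a ∈ T ∧ house (a : K) ≤ B}.Finite :=
  (finite_house_le K B).subset fun _ h => h.2

theorem boxCardIn_nonneg (T : Set (𝓞 K)) (B : ℝ) : 0 ≤ boxCardIn T B := Nat.cast_nonneg _

theorem boxCardIn_mono {T T' : Set (𝓞 K)} (h : T ⊆ T') (B : ℝ) :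
    boxCardIn T B ≤ boxCardIn T' B :=
  Nat.cast_le.mpr (Set.ncard_le_ncard (fun _ ha => ⟨h ha.1, ha.2⟩) (finite_mem_house_le _ _))

theorem boxCardIn_le_boxCard (T : Set (𝓞 K)) (B : ℝ) : boxCardIn T B ≤ boxCard K B :=
  Nat.cast_le.mpr (Set.ncard_le_ncard (fun _ ha => ha.2) (finite_house_le K B))

theorem boxCardIn_univ (B : ℝ) : boxCardIn (Set.univ : Set (𝓞 K)) B = boxCard K B := by
  simp [boxCardIn, boxCard]

theorem boxCardIn_union {T T' : Set (𝓞 K)} (h : Disjoint T T') (B : ℝ) :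
    boxCardIn (T ∪ T') B = boxCardIn T B + boxCardIn T' B := by
  rw [boxCardIn, boxCardIn, boxCardIn, ← Nat.cast_add, Nat.cast_inj,
    ← Set.ncard_union_eq (h.mono (fun _ h => h.1) (fun _ h => h.1))
      (finite_mem_house_le T B) (finite_mem_house_le T' B)]
  congr 1
  ext a
  simp only [Set.mem_ofPred_eq, Set.mem_union]
  tauto

theorem boxCard_mono {B B' : ℝ} (h : B ≤ B') : boxCard K B ≤ boxCard K B' :=
  Nat.cast_le.mpr (Set.ncard_le_ncard (fun _ ha => le_trans ha h) (finite_house_le K B'))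

theorem one_le_boxCard {B : ℝ} (hB : 0 ≤ B) : 1 ≤ boxCard K B := by
  rw [boxCard, Nat.one_le_cast, Nat.one_le_iff_ne_zero, ne_eq,
    Set.ncard_eq_zero (finite_house_le K B), ← ne_eq, ← Set.nonempty_iff_ne_empty]
  exact ⟨0, by simpa [house] using hB⟩

theorem boxCard_pos {B : ℝ} (hB : 0 ≤ B) : 0 < boxCard K B :=
  zero_lt_one.trans_le (one_le_boxCard hB)

variable (K)

/-- The asymptotics only concern large `B`. Below a threshold the lower bound comes from `0` lying
in the box, the upper one from monotonicity. -/
theorem exists_boxCard_bounds :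
    ∃ c C : ℝ, 0 < c ∧ 0 < C ∧
      (∀ B : ℝ, 0 ≤ B → c * B ^ Module.finrank ℚ K ≤ boxCard K B) ∧
      ∀ B : ℝ, 1 ≤ B → boxCard K B ≤ C * B ^ Module.finrank ℚ K := by
  obtain ⟨κ, hκ, hlim⟩ := exists_tendsto_ncard_house_le K
  set n := Module.finrank ℚ K
  have h1 : ∀ᶠ B : ℝ in atTop, κ / 2 ≤ boxCard K B / B ^ n ∧ boxCard K B / B ^ n ≤ 2 * κ :=
    (hlim.eventually (Icc_mem_nhds (by linarith : κ / 2 < κ) (by linarith : κ < 2 * κ)))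
  obtain ⟨X, hX⟩ := (h1.and (eventually_ge_atTop 1)).exists_forall_of_atTop
  have hX1 : 1 ≤ X := (hX X le_rfl).2
  have hXn : 0 < X ^ n := by positivity
  have key : ∀ B, X ≤ B → κ / 2 * B ^ n ≤ boxCard K B ∧ boxCard K B ≤ 2 * κ * B ^ n := by
    intro B hB
    have hBn : 0 < B ^ n := pow_pos (by linarith) n
    obtain ⟨⟨h2, h3⟩, -⟩ := hX B hB
    exact ⟨(le_div_iff₀ hBn).mp h2, (div_le_iff₀ hBn).mp h3⟩
  refine ⟨min (κ / 2) (1 / X ^ n), max (2 * κ) (boxCard K X), by positivity, by positivity, ?_, ?_⟩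
  · intro B hB
    rcases le_total X B with h | h
    · exact (mul_le_mul_of_nonneg_right (min_le_left _ _) (by positivity)).trans (key B h).1
    · refine (mul_le_mul_of_nonneg_right (min_le_right _ _) (by positivity)).trans ?_
      refine le_trans ?_ (one_le_boxCard hB)
      rw [one_div, inv_mul_le_iff₀ hXn, mul_one]
      exact pow_le_pow_left₀ hB h n
  · intro B hB
    have hBn : 1 ≤ B ^ n := one_le_pow₀ hB
    rcases le_total X B with h | h
    · exact (key B h).2.trans (mul_le_mul_of_nonneg_right (le_max_left _ _) (by positivity))
    · refine (boxCard_mono h).trans ((le_max_right (2 * κ) _).trans ?_)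
      exact le_mul_of_one_le_right (by positivity) hBn

theorem tendsto_boxCard_atTop : Tendsto (boxCard K) atTop atTop := by
  obtain ⟨c, C, hc, -, h, -⟩ := exists_boxCard_bounds K
  refine tendsto_atTop_mono' atTop (f₁ := fun B => c * B ^ Module.finrank ℚ K) ?_ ?_
  · filter_upwards [eventually_ge_atTop 0] with B hB using h B hB
  · exact (tendsto_pow_atTop Module.finrank_pos.ne').const_mul_atTop hc

/-- Boundary effects are negligible: this is what allows boxes to be translated by a bounded amount.
-/
theorem tendsto_boxCard_add_div (D : ℝ) :
    Tendsto (fun B => boxCard K (B + D) / boxCard K B) atTop (𝓝 1) := by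
  obtain ⟨κ, hκ, hlim⟩ := exists_tendsto_ncard_house_le K
  set n := Module.finrank ℚ K
  have h1 : Tendsto (fun B : ℝ => boxCard K (B + D) / (B + D) ^ n) atTop (𝓝 κ) :=
    hlim.comp (tendsto_atTop_add_const_right _ D tendsto_id)
  have h2 : Tendsto (fun B : ℝ => ((B + D) / B) ^ n) atTop (𝓝 1) := by
    have : Tendsto (fun B : ℝ => 1 + D / B) atTop (𝓝 (1 + 0)) :=
      tendsto_const_nhds.add (tendsto_const_nhds.div_atTop tendsto_id)
    rw [add_zero] at this
    have h3 := this.pow n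
    rw [one_pow] at h3
    refine h3.congr' ?_
    filter_upwards [eventually_gt_atTop 0] with B hB
    congr 1
    field_simp
  have h4 := (h1.mul h2).div hlim hκ.ne'
  rw [mul_one, div_self hκ.ne'] at h4
  refine h4.congr' ?_
  filter_upwards [eventually_gt_atTop 0, eventually_gt_atTop (-D)] with B hB hBD
  have h5 : 0 < B + D := by linarith
  have := (boxCard_pos (K := K) hB.le).ne'
  change boxCard K (B + D) / (B + D) ^ n * ((B + D) / B) ^ n / (boxCard K B / B ^ n) = _
  rw [div_pow]
  field_simp

variable {K}

theorem house_neg (a : K) : house (-a) = house a := by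
  simp [house]

theorem house_sub_le (a b : K) : house (a - b) ≤ house a + house b := by
  rw [sub_eq_add_neg, ← house_neg b]
  exact house_add_le _ _

/-- The norm of `I` divides that of `a`, which is a product of conjugates, each bounded by the
house. Thus non-zero elements of an ideal of large norm are large. -/
theorem absNorm_le_house_pow {I : Ideal (𝓞 K)} {a : 𝓞 K} (ha : a ∈ I) (ha0 : a ≠ 0) :
    (Ideal.absNorm I : ℝ) ≤ house (a : K) ^ Module.finrank ℚ K := by
  have h1 : (Ideal.absNorm I : ℤ) ∣ Algebra.norm ℤ a := Ideal.absNorm_dvd_norm_of_mem ha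
  have h2 : Algebra.norm ℤ a ≠ 0 := Algebra.norm_ne_zero_iff.mpr ha0
  have h3 : (Ideal.absNorm I : ℤ) ≤ |Algebra.norm ℤ a| :=
    Int.le_of_dvd (abs_pos.mpr h2) ((dvd_abs _ _).mpr h1)
  have h4 : ((Algebra.norm ℤ a : ℤ) : ℂ) = ∏ σ : K →ₐ[ℚ] ℂ, σ (a : K) := by
    rw [← Algebra.norm_eq_prod_embeddings ℚ ℂ (a : K)]
    rw [← Algebra.coe_norm_int]
    simp
  have h5 : (|Algebra.norm ℤ a| : ℝ) ≤ house (a : K) ^ Module.finrank ℚ K := by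
    have : (|Algebra.norm ℤ a| : ℝ) = ‖((Algebra.norm ℤ a : ℤ) : ℂ)‖ := by
      rw [Complex.norm_intCast]
    rw [this, h4, norm_prod]
    refine (Finset.prod_le_prod (g := fun _ : K →ₐ[ℚ] ℂ => house (a : K))
      (fun σ _ => norm_nonneg _) fun σ _ =>
      norm_embedding_le_house (a : K) (σ : K →+* ℂ)).trans ?_
    rw [Finset.prod_const, Finset.card_univ, AlgHom.card]
  refine le_trans ?_ h5
  exact_mod_cast h3

variable (K)

/-- A uniform upper bound for the number of non-zero elements of an ideal in a box. -/
theorem exists_boxCardIn_ideal_le :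
    ∃ C : ℝ, 0 < C ∧ ∀ I : Ideal (𝓞 K), I ≠ ⊥ → ∀ B : ℝ, 0 ≤ B →
      boxCardIn {a | a ∈ I ∧ a ≠ 0} B ≤ C * B ^ Module.finrank ℚ K / Ideal.absNorm I := by
  obtain ⟨c, C, hc, hC, hlow, hup⟩ := exists_boxCard_bounds K
  set n := Module.finrank ℚ K with hn
  have hn0 : n ≠ 0 := Module.finrank_pos.ne'
  refine ⟨C * 6 ^ n / c, by positivity, fun I hI B hB => ?_⟩
  have hN1 : 1 ≤ Ideal.absNorm I :=
    Nat.one_le_iff_ne_zero.mpr (Ideal.absNorm_eq_zero_iff.not.mpr hI)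
  have hN1' : (1 : ℝ) ≤ Ideal.absNorm I := by exact_mod_cast hN1
  set N : ℝ := (Ideal.absNorm I : ℝ) with hN
  rcases Set.eq_empty_or_nonempty {a : 𝓞 K | a ∈ {a | a ∈ I ∧ a ≠ 0} ∧ house (a : K) ≤ B}
    with he | ⟨x, ⟨hxI, hx0⟩, hxB⟩
  · rw [boxCardIn, he, Set.ncard_empty, Nat.cast_zero]; positivity
  -- `l` bounds from below the house of a non-zero element of `I`, hence the distance between
  -- distinct elements.
  set l : ℝ := N ^ ((n : ℝ)⁻¹) with hl
  have hl1 : 1 ≤ l := Real.one_le_rpow hN1' (by positivity)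
  have hln : l ^ n = N := Real.rpow_inv_natCast_pow (by positivity) hn0
  have hsep : ∀ a ∈ I, a ≠ 0 → l ≤ house (a : K) := by
    intro a ha ha0
    refine le_of_pow_le_pow_left₀ hn0 (house_nonneg _) ?_
    rw [hln]; exact absNorm_le_house_pow ha ha0
  have hlB : l ≤ B := (hsep x hxI hx0).trans hxB
  -- Packing argument: boxes of radius `l / 3` around elements of `I` are disjoint since `2 * l / 3
  -- < l`, and they fit into the box of radius `2 * B` since `l ≤ B`.
  have hprod : boxCardIn {a | a ∈ I ∧ a ≠ 0} B * boxCard K (l / 3) ≤ boxCard K (2 * B) := by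
    rw [boxCardIn, boxCard, boxCard, ← Nat.cast_mul, Nat.cast_le, ← Set.ncard_prod]
    refine Set.ncard_le_ncard_of_injOn (fun t => t.1 + t.2) ?_ ?_ (finite_house_le K _)
    · rintro ⟨a, t⟩ ⟨ha, ht⟩
      have h1 : house (a : K) ≤ B := ha.2
      have h2 : house (t : K) ≤ l / 3 := ht
      have := house_add_le (a : K) (t : K)
      change house ((a : K) + (t : K)) ≤ 2 * B
      linarith
    · rintro ⟨a, t⟩ ⟨ha, ht⟩ ⟨a', t'⟩ ⟨ha', ht'⟩ h
      have h' : a - a' = t' - t := by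
        have : a + t = a' + t' := h
        linear_combination this
      have haa : a = a' := by
        by_contra hne
        have h1 := hsep (a - a') (I.sub_mem ha.1.1 ha'.1.1) (sub_ne_zero.mpr hne)
        rw [h'] at h1
        change l ≤ house ((t' : K) - (t : K)) at h1
        have h2 := house_sub_le (t' : K) (t : K)
        have h3 : house (t : K) ≤ l / 3 := ht
        have h4 : house (t' : K) ≤ l / 3 := ht'
        linarith
      subst haa
      rw [sub_self] at h'
      rw [sub_eq_zero.mp h'.symm]
  have h1 := hlow (l / 3) (by positivity)
  have h2 := hup (2 * B) (by linarith)
  rw [div_pow, hln] at h1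
  have h3 : boxCardIn {a | a ∈ I ∧ a ≠ 0} B * (c * (N / 3 ^ n)) ≤ C * (2 * B) ^ n :=
    (mul_le_mul_of_nonneg_left h1 (boxCardIn_nonneg _ _)).trans (hprod.trans h2)
  rw [← le_div_iff₀ (by positivity)] at h3
  refine h3.trans (le_of_eq ?_)
  rw [show (6 : ℝ) ^ n = 2 ^ n * 3 ^ n by rw [← mul_pow]; norm_num, mul_pow]
  field_simp

end Counting

end DynMono

namespace DynMono

open Filter Topology Pointwise
open scoped Function

/-! ### Calculus of densities -/

section DensityCalculus

variable {K : Type*} [Field K] [NumberField K]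

theorem hasDensity_iff {S : Set (𝓞 K)} {δ : ℝ} :
    HasDensity S δ ↔ Tendsto (fun B => boxCardIn S B / boxCard K B) atTop (𝓝 δ) := Iff.rfl

theorem boxCardIn_eq_sum (T : Set (𝓞 K)) (B : ℝ) :
    boxCardIn T B = ∑ a ∈ (finite_house_le K B).toFinset, T.indicator (fun _ => (1 : ℝ)) a := by
  classical
  have h : {a : 𝓞 K | a ∈ T ∧ house (a : K) ≤ B} =
      ((finite_house_le K B).toFinset.filter (· ∈ T) : Finset (𝓞 K)) := by
    ext a; simp [and_comm]
  rw [boxCardIn, h, Set.ncard_coe_finset]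
  simp [Set.indicator_apply]

theorem hasSum_boxCardIn_iUnion {ι : Type*} {E : ι → Set (𝓞 K)} (hE : Pairwise (Disjoint on E))
    (B : ℝ) : HasSum (fun i => boxCardIn (E i) B) (boxCardIn (⋃ i, E i) B) := by
  simp only [boxCardIn_eq_sum]
  refine hasSum_sum fun a _ => ?_
  by_cases ha : ∃ j, a ∈ E j
  · obtain ⟨j, hj⟩ := ha
    have h1 : (⋃ i, E i).indicator (fun _ => (1 : ℝ)) a = (E j).indicator (fun _ => (1 : ℝ)) a := by
      rw [Set.indicator_of_mem hj, Set.indicator_of_mem (Set.mem_iUnion.mpr ⟨j, hj⟩)]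
    rw [h1]
    refine hasSum_single j fun i hi => ?_
    exact Set.indicator_of_notMem (fun h => Set.disjoint_left.mp (hE hi) h hj) _
  · rw [Set.indicator_of_notMem (by simpa using ha)]
    have : (fun i => (E i).indicator (fun _ => (1 : ℝ)) a) = fun _ => 0 := by
      funext i
      exact Set.indicator_of_notMem (fun h => ha ⟨i, h⟩) _
    rw [this]
    exact hasSum_zero

/-- Countable additivity of the density under domination (Tannery's theorem). -/
theorem hasDensity_iUnion {ι : Type*} {E : ι → Set (𝓞 K)} (hE : Pairwise (Disjoint on E))
    {d b : ι → ℝ} (hd : ∀ i, HasDensity (E i) (d i)) (hb : Summable b)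
    (hbd : ∀ᶠ B in atTop, ∀ i, boxCardIn (E i) B / boxCard K B ≤ b i) :
    HasDensity (⋃ i, E i) (∑' i, d i) := by
  rw [hasDensity_iff]
  refine (tendsto_tsum_of_dominated_convergence hb hd ?_).congr fun B => ?_
  · filter_upwards [hbd] with B hB i
    rw [Real.norm_of_nonneg (div_nonneg (Nat.cast_nonneg _) (Nat.cast_nonneg _))]
    exact hB i
  · exact ((hasSum_boxCardIn_iUnion hE B).div_const _).tsum_eq

theorem HasDensity.iUnion_finite {ι : Type*} [Finite ι] {E : ι → Set (𝓞 K)}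
    (hE : Pairwise (Disjoint on E)) {d : ι → ℝ} (hd : ∀ i, HasDensity (E i) (d i)) :
    HasDensity (⋃ i, E i) (∑' i, d i) := by
  refine hasDensity_iUnion hE hd (b := fun _ => 1) Summable.of_finite ?_
  filter_upwards [eventually_ge_atTop 0] with B hB i
  exact (div_le_one (boxCard_pos hB)).mpr (boxCardIn_le_boxCard _ _)

theorem HasDensity.nonneg {S : Set (𝓞 K)} {δ : ℝ} (h : HasDensity S δ) : 0 ≤ δ :=
  ge_of_tendsto' h fun _ => div_nonneg (Nat.cast_nonneg _) (Nat.cast_nonneg _)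

theorem HasDensity.sdiff_of_subset {S T : Set (𝓞 K)} {δ ε : ℝ} (hS : HasDensity S δ)
    (hT : HasDensity T ε) (h : T ⊆ S) : HasDensity (S \ T) (δ - ε) := by
  rw [hasDensity_iff] at *
  refine (hS.sub hT).congr fun B => ?_
  rw [← sub_div]
  congr 1
  have := boxCardIn_union (Set.disjoint_sdiff_right (s := T) (t := S)) B
  rw [Set.union_sdiff_cancel h] at this
  linarith

theorem HasDensity.of_subset_zero {S T : Set (𝓞 K)} (hT : HasDensity T 0) (h : S ⊆ T) :
    HasDensity S 0 :=
  squeeze_zero (fun _ => div_nonneg (Nat.cast_nonneg _) (Nat.cast_nonneg _))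
    (fun B => div_le_div_of_nonneg_right (boxCardIn_mono h B) (Nat.cast_nonneg _)) hT

theorem HasDensity.sdiff_zero {S Z : Set (𝓞 K)} {δ : ℝ} (hS : HasDensity S δ)
    (hZ : HasDensity Z 0) : HasDensity (S \ Z) δ := by
  have h := hS.sdiff_of_subset (hZ.of_subset_zero (Set.inter_subset_right (s := S)))
    Set.inter_subset_left
  rwa [Set.sdiff_self_inter, sub_zero] at h

theorem hasDensity_univ : HasDensity (Set.univ : Set (𝓞 K)) 1 := by
  rw [hasDensity_iff]
  refine tendsto_const_nhds.congr' ?_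
  filter_upwards [eventually_ge_atTop 0] with B hB
  rw [boxCardIn_univ, div_self (boxCard_pos hB).ne']

theorem HasDensity.unique {S : Set (𝓞 K)} {δ ε : ℝ} (h : HasDensity S δ) (h' : HasDensity S ε) :
    δ = ε :=
  tendsto_nhds_unique h h'

theorem hasDensity_zero_of_finite {S : Set (𝓞 K)} (hS : S.Finite) : HasDensity S 0 := by
  rw [hasDensity_iff]
  refine squeeze_zero (fun _ => div_nonneg (Nat.cast_nonneg _) (Nat.cast_nonneg _))
    (g := fun B => (S.ncard : ℝ) / boxCard K B) (fun B => ?_) ?_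
  · refine div_le_div_of_nonneg_right ?_ (Nat.cast_nonneg _)
    exact Nat.cast_le.mpr (Set.ncard_le_ncard (fun _ h => h.1) hS)
  · exact tendsto_const_nhds.div_atTop (tendsto_boxCard_atTop K)

theorem hasDensity_empty : HasDensity (∅ : Set (𝓞 K)) 0 :=
  hasDensity_zero_of_finite Set.finite_empty

theorem HasDensity.nonempty {S : Set (𝓞 K)} {δ : ℝ} (h : HasDensity S δ) (hδ : 0 < δ) :
    S.Nonempty := by
  by_contra hS
  rw [Set.not_nonempty_iff_eq_empty] at hS
  subst hS
  exact hδ.ne' (h.unique hasDensity_empty)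

/-- Translation by `b - a` carries one residue class injectively into the other and enlarges the box
by at most `D`. -/
theorem boxCardIn_mk_le {J : Ideal (𝓞 K)} (a b : 𝓞 K) (B : ℝ) {D : ℝ}
    (hD : house ((b - a : 𝓞 K) : K) ≤ D) :
    boxCardIn {x | Ideal.Quotient.mk J x = Ideal.Quotient.mk J a} B ≤
      boxCardIn {x | Ideal.Quotient.mk J x = Ideal.Quotient.mk J b} (B + D) := by
  rw [boxCardIn, boxCardIn, Nat.cast_le]
  refine Set.ncard_le_ncard_of_injOn (fun x => x + (b - a)) ?_ (add_left_injective _).injOn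
    (finite_mem_house_le _ _)
  rintro x ⟨hx, hxB⟩
  refine ⟨?_, ?_⟩
  · rw [Set.mem_ofPred_eq] at hx ⊢
    rw [map_add, map_sub, hx]
    ring
  · change house ((x : K) + ((b - a : 𝓞 K) : K)) ≤ B + D
    exact (house_add_le _ _).trans (add_le_add hxB hD)

/-- A residue class modulo a non-zero ideal has density the inverse of the norm of the ideal. -/
theorem hasDensity_mk_eq {J : Ideal (𝓞 K)} (hJ : J ≠ ⊥) (q : 𝓞 K ⧸ J) :
    HasDensity {x | Ideal.Quotient.mk J x = q} (1 / (Ideal.absNorm J : ℝ)) := by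
  classical
  have : Finite (𝓞 K ⧸ J) := Ideal.finiteQuotientOfFreeOfNeBot J hJ
  have : Fintype (𝓞 K ⧸ J) := Fintype.ofFinite _
  have hcard : (Fintype.card (𝓞 K ⧸ J) : ℝ) = Ideal.absNorm J := by
    rw [Ideal.absNorm_apply, Submodule.cardQuot_apply, Nat.card_eq_fintype_card]
  have hN : (0 : ℝ) < Ideal.absNorm J :=
    Nat.cast_pos.mpr (Nat.pos_of_ne_zero (Ideal.absNorm_eq_zero_iff.not.mpr hJ))
  obtain ⟨r, hr⟩ : ∃ r : 𝓞 K ⧸ J → 𝓞 K, ∀ q, Ideal.Quotient.mk J (r q) = q :=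
    Ideal.Quotient.mk_surjective.hasRightInverse
  set D : ℝ := ∑ i, ∑ j, house ((r i - r j : 𝓞 K) : K) with hDdef
  have hD : ∀ i j, house ((r i - r j : 𝓞 K) : K) ≤ D := by
    intro i j
    refine (Finset.single_le_sum (f := fun j => house ((r i - r j : 𝓞 K) : K))
      (fun j _ => house_nonneg _) (Finset.mem_univ j)).trans ?_
    exact Finset.single_le_sum (f := fun i => ∑ j, house ((r i - r j : 𝓞 K) : K))
      (fun j _ => Finset.sum_nonneg fun _ _ => house_nonneg _) (Finset.mem_univ i)
  set E : 𝓞 K ⧸ J → Set (𝓞 K) := fun q => {x | Ideal.Quotient.mk J x = q} with hE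
  have hle : ∀ i j B, boxCardIn (E i) B ≤ boxCardIn (E j) (B + D) := by
    intro i j B
    have := boxCardIn_mk_le (J := J) (r i) (r j) B (hD j i)
    rwa [hr, hr] at this
  have htot : ∀ B, boxCard K B = ∑ i, boxCardIn (E i) B := by
    intro B
    have hdis : Pairwise (Disjoint on E) := by
      intro i j hij
      refine Set.disjoint_left.mpr fun x hx hx' => hij ?_
      exact hx.symm.trans hx'
    have h1 := (hasSum_boxCardIn_iUnion hdis B).unique (hasSum_fintype _)
    have h2 : ⋃ i, E i = Set.univ := Set.eq_univ_of_forall fun x => Set.mem_iUnion.mpr ⟨_, rfl⟩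
    rw [h2, boxCardIn_univ] at h1
    exact h1
  -- Sum the comparison of `E q` with each class over all classes; `hlow` is the mirror image.
  have hup : ∀ B, boxCardIn (E q) B ≤ boxCard K (B + D) / Ideal.absNorm J := by
    intro B
    rw [le_div_iff₀ hN, ← hcard, htot, mul_comm, ← nsmul_eq_mul]
    have := Finset.card_nsmul_le_sum Finset.univ (fun i => boxCardIn (E i) (B + D))
      (boxCardIn (E q) B) (fun i _ => hle q i B)
    simpa using this
  have hlow : ∀ B, boxCard K (B + -D) / Ideal.absNorm J ≤ boxCardIn (E q) B := by
    intro B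
    rw [div_le_iff₀ hN, ← hcard, htot, mul_comm, ← nsmul_eq_mul]
    have := Finset.sum_le_card_nsmul Finset.univ (fun i => boxCardIn (E i) (B + -D))
      (boxCardIn (E q) B) (fun i _ => by simpa using hle i q (B + -D))
    simpa using this
  rw [hasDensity_iff]
  refine tendsto_of_tendsto_of_tendsto_of_le_of_le
    ((tendsto_boxCard_add_div K (-D)).div_const (Ideal.absNorm J : ℝ))
    ((tendsto_boxCard_add_div K D).div_const (Ideal.absNorm J : ℝ)) (fun B => ?_) (fun B => ?_)
  · simp only
    rw [div_right_comm]
    exact div_le_div_of_nonneg_right (hlow B) (Nat.cast_nonneg _)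
  · simp only
    rw [div_right_comm]
    exact div_le_div_of_nonneg_right (hup B) (Nat.cast_nonneg _)

theorem hasDensity_sub_mem {J : Ideal (𝓞 K)} (hJ : J ≠ ⊥) (c : 𝓞 K) :
    HasDensity {x | x - c ∈ J} (1 / (Ideal.absNorm J : ℝ)) := by
  simp_rw [← Ideal.Quotient.eq]
  exact hasDensity_mk_eq hJ _

/-- A union of residue classes modulo a non-zero ideal has a density. -/
theorem exists_hasDensity_of_periodic {J : Ideal (𝓞 K)} (hJ : J ≠ ⊥) {E : Set (𝓞 K)}
    (hE : ∀ a ∈ E, ∀ b, b - a ∈ J → b ∈ E) : ∃ δ, HasDensity E δ := by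
  have : Finite (𝓞 K ⧸ J) := Ideal.finiteQuotientOfFreeOfNeBot J hJ
  have hU : E = ⋃ q : {q : 𝓞 K ⧸ J // ∃ a ∈ E, Ideal.Quotient.mk J a = q},
      {x | Ideal.Quotient.mk J x = q} := by
    ext x
    simp only [Set.mem_iUnion, Set.mem_ofPred_eq, Subtype.exists]
    constructor
    · intro hx
      exact ⟨_, ⟨x, hx, rfl⟩, rfl⟩
    · rintro ⟨_, ⟨a, ha, rfl⟩, hx⟩
      exact hE a ha x (Ideal.Quotient.eq.mp hx)
  rw [hU]
  refine ⟨_, HasDensity.iUnion_finite ?_ fun q => hasDensity_mk_eq hJ q.1⟩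
  intro i j hij
  refine Set.disjoint_left.mpr fun x hx hx' => hij (Subtype.ext ?_)
  exact hx.symm.trans hx'

end DensityCalculus

/-! ### Convergence of the sum of `N(p) ^ (-2)` -/

section PrimeSum

variable (K : Type*) [Field K] [NumberField K]

/-- The number of ideals of norm at most `n` is `O(n)`, so the Dirichlet series counting ideals
converges at `2` by partial summation. -/
theorem summable_card_absNorm_div_sq :
    Summable fun n : ℕ =>
      (Nat.card {I : Ideal (𝓞 K) // Ideal.absNorm I = n} : ℝ) / (n : ℝ) ^ 2 := by
  have hO : (fun n : ℕ => ∑ k ∈ Finset.Icc 1 n,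
      (Nat.card {I : Ideal (𝓞 K) // Ideal.absNorm I = k} : ℝ)) =O[atTop]
        fun n => (n : ℝ) ^ (1 : ℝ) := by
    have h1 := (Ideal.tendsto_norm_le_div_atTop₀ K).comp tendsto_natCast_atTop_atTop
    have h2 := h1.isBigO_one ℝ
    have h3 := h2.mul (Asymptotics.isBigO_refl (fun n : ℕ => (n : ℝ)) atTop)
    refine (h3.congr' ?_ ?_)
    · filter_upwards [eventually_gt_atTop 0] with n hn
      have hn' : (n : ℝ) ≠ 0 := by exact_mod_cast hn.ne'
      simp only [Function.comp_apply, Nat.cast_le]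
      rw [div_mul_cancel₀ _ hn', ← Nat.cast_sum]
      congr 1
      -- The added `1` accounts for the zero ideal, the only one of norm `0`.
      rw [← add_left_inj 1, ← Ideal.card_norm_le_eq_card_norm_le_add_one,
        show Finset.Icc 1 n = Finset.Ioc 0 n from Finset.Icc_succ_left_eq_Ioc _ _,
        show 1 = Nat.card {I : Ideal (𝓞 K) // Ideal.absNorm I = 0} by
          simp [Ideal.absNorm_eq_zero_iff],
        Finset.sum_Ioc_add_eq_sum_Icc (n.zero_le),
        ← Finset.card_preimage_eq_sum_card_image_eq (fun k _ ↦ Ideal.finite_setOfPred_absNorm_eq k)]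
      simp [Set.coe_eq_subtype]
    · filter_upwards with n
      simp
  have h := LSeriesSummable_of_sum_norm_bigO_and_nonneg (s := 2) hO (fun _ => Nat.cast_nonneg _)
    zero_le_one (by norm_num)
  have h' := h.norm
  refine (summable_nat_add_iff 1).mp (((summable_nat_add_iff 1).mpr h').congr fun n => ?_)
  rw [LSeries.term_of_ne_zero (by omega), norm_div, Complex.cpow_ofNat, norm_pow,
    Complex.norm_natCast, Complex.norm_real, Real.norm_of_nonneg (Nat.cast_nonneg _)]

theorem summable_inv_absNorm_sq :
    Summable fun v : HeightOneSpectrum (𝓞 K) => 1 / (Ideal.absNorm v.asIdeal : ℝ) ^ 2 := by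
  classical
  set g : ℕ → ℝ := fun n => (Nat.card {I : Ideal (𝓞 K) // Ideal.absNorm I = n} : ℝ) / (n : ℝ) ^ 2
    with hg
  have hs : Summable g := summable_card_absNorm_div_sq K
  have hg0 : ∀ n, 0 ≤ g n := fun n => div_nonneg (Nat.cast_nonneg _) (sq_nonneg _)
  have hcount : ∀ (u : Finset (HeightOneSpectrum (𝓞 K))) (n : ℕ),
      (u.filter fun v => Ideal.absNorm v.asIdeal = n).card ≤
        Nat.card {I : Ideal (𝓞 K) // Ideal.absNorm I = n} := by
    intro u n
    have hfin : Finite {I : Ideal (𝓞 K) // Ideal.absNorm I = n} :=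
      (Ideal.finite_setOfPred_absNorm_eq n).to_subtype
    rw [← Nat.card_eq_finsetCard]
    refine Nat.card_le_card_of_injective
      (fun v => ⟨v.1.asIdeal, (Finset.mem_filter.mp v.2).2⟩) fun v w h => ?_
    exact Subtype.ext (HeightOneSpectrum.ext (congrArg Subtype.val h))
  refine summable_of_sum_le (c := ∑' n, g n)
    (fun v => div_nonneg zero_le_one (sq_nonneg _)) fun u => ?_
  rw [Finset.sum_comp (fun n : ℕ => 1 / (n : ℝ) ^ 2)
    (fun v : HeightOneSpectrum (𝓞 K) => Ideal.absNorm v.asIdeal)]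
  refine le_trans (Finset.sum_le_sum (g := g) fun n _ => ?_) (hs.sum_le_tsum _ fun n _ => hg0 n)
  rw [nsmul_eq_mul, mul_one_div]
  exact div_le_div_of_nonneg_right (Nat.cast_le.mpr (hcount u n)) (sq_nonneg _)

end PrimeSum

end DynMono

namespace DynMono

open Filter Topology Pointwise
open scoped Function

/-! ### Sieving by residue classes modulo squares of primes -/

section Sieve

variable {K : Type*} [Field K] [NumberField K]

omit [NumberField K] in
theorem sq_asIdeal_ne_bot (v : HeightOneSpectrum (𝓞 K)) : v.asIdeal ^ 2 ≠ ⊥ :=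
  pow_ne_zero 2 v.ne_bot

omit [NumberField K] in
theorem prod_sq_asIdeal_ne_bot (F : Finset (HeightOneSpectrum (𝓞 K))) :
    ∏ v ∈ F, v.asIdeal ^ 2 ≠ ⊥ :=
  Finset.prod_ne_zero_iff.mpr fun v _ => sq_asIdeal_ne_bot v

theorem absNorm_sq_asIdeal (v : HeightOneSpectrum (𝓞 K)) :
    (Ideal.absNorm (v.asIdeal ^ 2) : ℝ) = (Ideal.absNorm v.asIdeal : ℝ) ^ 2 := by
  rw [map_pow, Nat.cast_pow]

theorem isCoprime_sq_asIdeal {v w : HeightOneSpectrum (𝓞 K)} (h : v ≠ w) :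
    IsCoprime (v.asIdeal ^ 2) (w.asIdeal ^ 2) := by
  refine IsCoprime.pow ?_
  have := v.isMaximal
  have := w.isMaximal
  exact Ideal.isCoprime_of_isMaximal fun h' => h (HeightOneSpectrum.ext h')

/-- The density of the intersection of two residue classes for coprime moduli. -/
theorem hasDensity_sub_mem_inter {I J : Ideal (𝓞 K)} (hI : I ≠ ⊥) (hJ : J ≠ ⊥)
    (hIJ : IsCoprime I J) (c d : 𝓞 K) :
    HasDensity {x | x - c ∈ I ∧ x - d ∈ J}
      (1 / ((Ideal.absNorm I : ℝ) * (Ideal.absNorm J : ℝ))) := by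
  obtain ⟨i, hi, j, hj, hij⟩ := Ideal.isCoprime_iff_exists.mp hIJ
  -- As `i + j = 1`, the element `c * j + d * i` is the Chinese remainder solution.
  have hset : {x | x - c ∈ I ∧ x - d ∈ J} = {x | x - (c * j + d * i) ∈ I * J} := by
    ext x
    rw [Set.mem_ofPred_eq, Set.mem_ofPred_eq, Ideal.mul_eq_inf_of_isCoprime hIJ, Ideal.mem_inf]
    have h1 : x - (c * j + d * i) = (x - c) + i * (c - d) := by linear_combination c * hij.symm
    have h2 : x - (c * j + d * i) = (x - d) + j * (d - c) := by linear_combination d * hij.symm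
    refine and_congr ?_ ?_
    · rw [h1]; exact (Ideal.add_mem_iff_left _ (I.mul_mem_right _ hi)).symm
    · rw [h2]; exact (Ideal.add_mem_iff_left _ (J.mul_mem_right _ hj)).symm
  rw [hset, ← Nat.cast_mul, ← map_mul]
  exact hasDensity_sub_mem (mul_ne_zero hI hJ) _

/-- The set of elements congruent modulo `v ^ 2` to an element of `Ω`. -/
def nearSet (Ω : Finset (𝓞 K)) (v : HeightOneSpectrum (𝓞 K)) : Set (𝓞 K) :=
  {a | ∃ ω ∈ Ω, a - ω ∈ v.asIdeal ^ 2}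

omit [NumberField K] in
theorem mem_nearSet_of_sub_mem {Ω : Finset (𝓞 K)} {v : HeightOneSpectrum (𝓞 K)} {a b : 𝓞 K}
    (hab : b - a ∈ v.asIdeal ^ 2) (ha : a ∈ nearSet Ω v) : b ∈ nearSet Ω v := by
  obtain ⟨ω, hω, haω⟩ := ha
  refine ⟨ω, hω, ?_⟩
  have := Ideal.add_mem _ hab haω
  rwa [sub_add_sub_cancel] at this

/-- The part of a residue class lying in `nearSet Ω v` but in none of finitely many further sets
`nearSet Ω w` has a density. -/
theorem exists_hasDensity_nearSet_sdiff (Ω : Finset (𝓞 K)) {I : Ideal (𝓞 K)} (hI : I ≠ ⊥)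
    (c : 𝓞 K) (v : HeightOneSpectrum (𝓞 K)) {W : Set (HeightOneSpectrum (𝓞 K))} (hW : W.Finite) :
    ∃ δ, HasDensity
      {a | a - c ∈ I ∧ a ∈ nearSet Ω v ∧ ∀ w ∈ W, a ∉ nearSet Ω w} δ := by
  set P : Ideal (𝓞 K) := ∏ w ∈ hW.toFinset, w.asIdeal ^ 2 with hP
  have hJ : I * (v.asIdeal ^ 2 * P) ≠ ⊥ :=
    mul_ne_zero hI (mul_ne_zero (sq_asIdeal_ne_bot v) (prod_sq_asIdeal_ne_bot _))
  have h1 : I * (v.asIdeal ^ 2 * P) ≤ I := Ideal.mul_le_left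
  have h2 : I * (v.asIdeal ^ 2 * P) ≤ v.asIdeal ^ 2 :=
    Ideal.mul_le_right.trans Ideal.mul_le_left
  have h3 : ∀ w ∈ W, I * (v.asIdeal ^ 2 * P) ≤ w.asIdeal ^ 2 := fun w hw =>
    (Ideal.mul_le_right.trans Ideal.mul_le_right).trans
      (Ideal.dvd_iff_le.mp (Finset.dvd_prod_of_mem _ (hW.mem_toFinset.mpr hw)))
  refine exists_hasDensity_of_periodic hJ fun a ha b hab => ?_
  refine ⟨?_, mem_nearSet_of_sub_mem (h2 hab) ha.2.1, fun w hw hbw =>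
    ha.2.2 w hw (mem_nearSet_of_sub_mem ?_ hbw)⟩
  · have := Ideal.add_mem _ (h1 hab) ha.1
    rwa [sub_add_sub_cancel] at this
  · rw [← neg_sub, neg_mem_iff]
    exact h3 w hw hab

/-- The set is covered by one residue class modulo `I * v ^ 2` for each element of `Ω`. The factor
`1 / N(I)` is what makes the sieve bound proportional to the density of the starting class. -/
theorem HasDensity.le_of_subset_nearSet {Ω : Finset (𝓞 K)} {I : Ideal (𝓞 K)} (hI : I ≠ ⊥)
    {c : 𝓞 K} {v : HeightOneSpectrum (𝓞 K)} (hv : IsCoprime I (v.asIdeal ^ 2)) {E : Set (𝓞 K)}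
    {d : ℝ} (hd : HasDensity E d) (hE : ∀ a ∈ E, a - c ∈ I ∧ a ∈ nearSet Ω v) :
    d ≤ (Ω.card : ℝ) / Ideal.absNorm I * (1 / (Ideal.absNorm v.asIdeal : ℝ) ^ 2) := by
  have h1 := tendsto_finsetSum Ω fun ω _ => hasDensity_iff.mp
    (hasDensity_sub_mem_inter hI (sq_asIdeal_ne_bot v) hv c ω)
  rw [Finset.sum_const, nsmul_eq_mul, absNorm_sq_asIdeal, mul_one_div, ← div_div,
    div_eq_mul_one_div] at h1
  refine le_of_tendsto_of_tendsto' (hasDensity_iff.mp hd) h1 fun B => ?_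
  rw [← Finset.sum_div]
  refine div_le_div_of_nonneg_right ?_ (Nat.cast_nonneg _)
  simp only [boxCardIn]
  rw [← Nat.cast_sum, Nat.cast_le]
  refine (Set.ncard_le_ncard ?_ ?_).trans (Finset.set_ncard_biUnion_le Ω _)
  · rintro a ⟨haE, haB⟩
    obtain ⟨haT, ω, hω, haω⟩ := hE a haE
    exact Set.mem_biUnion hω ⟨⟨haT, haω⟩, haB⟩
  · exact Ω.finite_toSet.biUnion fun ω _ => finite_mem_house_le _ _

/-- Uniformly in `v`, few elements of a large box are congruent modulo `v ^ 2` to an element of a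
given finite set without belonging to that set. -/
theorem exists_boxCardIn_near_le (Ω : Finset (𝓞 K)) :
    ∃ C : ℝ, ∀ᶠ B in atTop, ∀ v : HeightOneSpectrum (𝓞 K),
      boxCardIn (nearSet Ω v \ Ω) B / boxCard K B ≤
        C * (1 / (Ideal.absNorm v.asIdeal : ℝ) ^ 2) := by
  obtain ⟨C, hC, hCI⟩ := exists_boxCardIn_ideal_le K
  obtain ⟨c, -, hc, -, hlow, -⟩ := exists_boxCard_bounds K
  set n := Module.finrank ℚ K
  set H : ℝ := ∑ ω ∈ Ω, house (ω : K) with hH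
  have hH0 : 0 ≤ H := Finset.sum_nonneg fun _ _ => house_nonneg _
  have hHle : ∀ ω ∈ Ω, house (ω : K) ≤ H := fun ω hω =>
    Finset.single_le_sum (f := fun ω : 𝓞 K => house (ω : K)) (fun _ _ => house_nonneg _) hω
  refine ⟨Ω.card * (C * (1 + H) ^ n / c), ?_⟩
  filter_upwards [eventually_ge_atTop 1] with B hB v
  have hN : (0 : ℝ) < Ideal.absNorm v.asIdeal :=
    Nat.cast_pos.mpr (Nat.pos_of_ne_zero (Ideal.absNorm_eq_zero_iff.not.mpr v.ne_bot))
  have hB0 : 0 ≤ B := by linarith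
  rw [div_le_iff₀ (boxCard_pos hB0)]
  -- Off `Ω` the difference `a - ω` is a non-zero element of `v ^ 2`, so the ideal bound applies.
  -- Elements of `Ω` would be counted at every `v` and spoil uniformity.
  have h1 : boxCardIn (nearSet Ω v \ Ω) B ≤
      ∑ ω ∈ Ω, boxCardIn {a | a ∈ v.asIdeal ^ 2 ∧ a ≠ 0} (B + H) := by
    rw [Finset.sum_const, nsmul_eq_mul, boxCardIn, boxCardIn, ← Nat.cast_mul, Nat.cast_le,
      ← Set.ncard_coe_finset Ω, ← Set.ncard_prod]
    refine (Set.ncard_le_ncard (t := (fun t : 𝓞 K × 𝓞 K => t.1 + t.2) ''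
      ((Ω : Set (𝓞 K)) ×ˢ {a | a ∈ {a | a ∈ v.asIdeal ^ 2 ∧ a ≠ 0} ∧ house (a : K) ≤ B + H}))
      ?_ ?_).trans (Set.ncard_image_le ?_)
    · rintro a ⟨⟨⟨ω, hω, haω⟩, ha⟩, haB⟩
      refine ⟨(ω, a - ω), ⟨hω, ⟨haω, fun h => ha ?_⟩, ?_⟩, by simp⟩
      · rwa [sub_eq_zero.mp h]
      · change house ((a : K) - (ω : K)) ≤ B + H
        exact (house_sub_le _ _).trans (add_le_add haB (hHle ω hω))
    · exact (Ω.finite_toSet.prod (finite_mem_house_le _ _)).image _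
    · exact Ω.finite_toSet.prod (finite_mem_house_le _ _)
  refine h1.trans ?_
  rw [Finset.sum_const, nsmul_eq_mul, mul_assoc, mul_assoc]
  refine mul_le_mul_of_nonneg_left ?_ (Nat.cast_nonneg _)
  refine (hCI _ (sq_asIdeal_ne_bot v) _ (by linarith)).trans ?_
  rw [absNorm_sq_asIdeal]
  have h2 : (B + H) ^ n ≤ (1 + H) ^ n * (boxCard K B / c) := by
    have h3 : (B + H) ^ n ≤ ((1 + H) * B) ^ n :=
      pow_le_pow_left₀ (by linarith) (by nlinarith) n
    rw [mul_pow] at h3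
    refine h3.trans (mul_le_mul_of_nonneg_left ?_ (by positivity))
    rw [le_div_iff₀ hc, mul_comm]
    exact hlow B hB0
  calc C * (B + H) ^ n / (Ideal.absNorm v.asIdeal : ℝ) ^ 2
      ≤ C * ((1 + H) ^ n * (boxCard K B / c)) / (Ideal.absNorm v.asIdeal : ℝ) ^ 2 := by gcongr
    _ = _ := by field_simp

-- A summable family with non-zero terms has a countable index set. The sieve uses an enumeration of
-- the primes to make its exceptional sets disjoint.
variable (K) in
theorem countable_heightOneSpectrum : Countable (HeightOneSpectrum (𝓞 K)) := by
  have h := (summable_inv_absNorm_sq K).countable_support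
  have hu : Function.support (fun v : HeightOneSpectrum (𝓞 K) =>
      1 / (Ideal.absNorm v.asIdeal : ℝ) ^ 2) = Set.univ := by
    refine Set.eq_univ_of_forall fun v => ?_
    have : (Ideal.absNorm v.asIdeal : ℝ) ≠ 0 :=
      Nat.cast_ne_zero.mpr (Ideal.absNorm_eq_zero_iff.not.mpr v.ne_bot)
    rw [Function.mem_support]
    positivity
  rw [hu] at h
  exact Set.countable_univ_iff.mp h

/-- Given finitely many primes `V` and residue classes `c v` modulo `v ^ 2` which for `v ∉ V` avoid
the finite set `Ω`, there is a set of positive density whose elements lie in the class of `c v` for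
`v ∈ V` and are not congruent to an element of `Ω` modulo `v ^ 2` for `v ∉ V`. -/
theorem exists_hasDensity_sieve (Ω : Finset (𝓞 K)) {V : Set (HeightOneSpectrum (𝓞 K))}
    (hV : V.Finite) (c : HeightOneSpectrum (𝓞 K) → 𝓞 K)
    (hc : ∀ v ∉ V, ∀ ω ∈ Ω, ω - c v ∉ v.asIdeal ^ 2) :
    ∃ (S : Set (𝓞 K)) (δ : ℝ), 0 < δ ∧ HasDensity S δ ∧ ∀ a ∈ S,
      (∀ v ∈ V, a - c v ∈ v.asIdeal ^ 2) ∧ ∀ v ∉ V, ∀ ω ∈ Ω, a - ω ∉ v.asIdeal ^ 2 := by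
  classical
  have hsum := summable_inv_absNorm_sq K
  set b : HeightOneSpectrum (𝓞 K) → ℝ := fun v => 1 / (Ideal.absNorm v.asIdeal : ℝ) ^ 2 with hb
  have hb0 : ∀ v, 0 ≤ b v := fun v => by positivity
  -- Primes in `F` are handled by a single class `c₀` modulo `I`. The tail outside `F` is so small
  -- that it cannot exhaust this class.
  obtain ⟨F, hVF, hF⟩ : ∃ F : Finset (HeightOneSpectrum (𝓞 K)), V ⊆ F ∧
      (Ω.card : ℝ) * ∑' v : {v // v ∉ F}, b v < 1 := by
    have h1 := (tendsto_tsum_compl_atTop_zero b).const_mul (Ω.card : ℝ)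
    rw [mul_zero] at h1
    obtain ⟨F, hF1, hF2⟩ := ((h1.eventually (gt_mem_nhds zero_lt_one)).and
      (eventually_ge_atTop hV.toFinset)).exists
    exact ⟨F, fun v hv => hF2 (hV.mem_toFinset.mpr hv), hF1⟩
  set I : Ideal (𝓞 K) := ∏ v ∈ F, v.asIdeal ^ 2 with hIdef
  have hI : I ≠ ⊥ := prod_sq_asIdeal_ne_bot F
  have hIN : (0 : ℝ) < Ideal.absNorm I :=
    Nat.cast_pos.mpr (Nat.pos_of_ne_zero (Ideal.absNorm_eq_zero_iff.not.mpr hI))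
  have hIle : ∀ v ∈ F, I ≤ v.asIdeal ^ 2 := fun v hv =>
    Ideal.dvd_iff_le.mp (Finset.dvd_prod_of_mem _ hv)
  have hIcop : ∀ v ∉ F, IsCoprime I (v.asIdeal ^ 2) := fun v hv =>
    IsCoprime.prod_left fun w hw => isCoprime_sq_asIdeal fun h => hv (h ▸ hw)
  obtain ⟨c₀, hc₀⟩ := IsDedekindDomain.exists_forall_sub_mem_ideal (s := F)
    (fun v => v.asIdeal) (fun _ => 2) (fun v _ => v.prime)
    (fun v _ w _ h h' => h (HeightOneSpectrum.ext h')) (fun v => c v)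
  have hc₀ : ∀ v ∈ F, c₀ - c v ∈ v.asIdeal ^ 2 := fun v hv => hc₀ v hv
  have hTd : HasDensity {a | a - c₀ ∈ I} (1 / (Ideal.absNorm I : ℝ)) := hasDensity_sub_mem hI c₀
  have := countable_heightOneSpectrum K
  obtain ⟨e, he⟩ := Countable.exists_injective_nat (HeightOneSpectrum (𝓞 K))
  -- Each bad element is assigned to its bad prime outside `F` of least index, so that the sets are
  -- disjoint and each involves only finitely many congruences.
  let E : {v // v ∉ F} → Set (𝓞 K) := fun v =>
    {a | a - c₀ ∈ I ∧ a ∈ nearSet Ω v ∧ ∀ w ∈ {w | w ∉ F ∧ e w < e v}, a ∉ nearSet Ω w}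
  have hEd : ∀ v, ∃ δ, HasDensity (E v \ Ω) δ := by
    intro v
    have hfin : {w | w ∉ F ∧ e w < e v}.Finite :=
      ((Set.finite_Iio (e v)).preimage he.injOn).subset fun w hw => hw.2
    obtain ⟨δ, hδ⟩ := exists_hasDensity_nearSet_sdiff Ω hI c₀ v.1 hfin
    exact ⟨δ, hδ.sdiff_zero (hasDensity_zero_of_finite Ω.finite_toSet)⟩
  choose d hd using hEd
  have hdle : ∀ v, d v ≤ (Ω.card : ℝ) / Ideal.absNorm I * b v := fun v =>
    (hd v).le_of_subset_nearSet hI (hIcop v.1 v.2) fun a ha => ⟨ha.1.1, ha.1.2.1⟩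
  obtain ⟨C, hC⟩ := exists_boxCardIn_near_le Ω
  have hdis : Pairwise (Disjoint on fun v => E v \ (Ω : Set (𝓞 K))) := by
    intro v w hvw
    refine Set.disjoint_left.mpr ?_
    rintro a ⟨⟨-, hv, hv'⟩, -⟩ ⟨⟨-, hw, hw'⟩, -⟩
    rcases lt_trichotomy (e v) (e w) with h | h | h
    · exact hw' v ⟨v.2, h⟩ hv
    · exact hvw (Subtype.ext (he h))
    · exact hv' w ⟨w.2, h⟩ hw
  -- Infinitely many primes are treated at once by dominated convergence; the majorant is uniform in
  -- the box because `Ω` has been removed.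
  have hU := hasDensity_iUnion hdis hd (b := fun v => C * b v)
    ((hsum.subtype _).mul_left C) (by
      filter_upwards [hC, eventually_ge_atTop 0] with B hB hB0 v
      refine le_trans ?_ (hB v.1)
      refine div_le_div_of_nonneg_right (boxCardIn_mono ?_ B) (boxCard_pos hB0).le
      rintro a ⟨⟨-, ha, -⟩, haΩ⟩
      exact ⟨ha, haΩ⟩)
  have hdsum : ∑' v, d v ≤ (Ω.card : ℝ) / Ideal.absNorm I * ∑' v : {v // v ∉ F}, b v := by
    rw [← tsum_mul_left]
    have hs := (hsum.subtype {v | v ∉ F}).mul_left ((Ω.card : ℝ) / Ideal.absNorm I)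
    exact Summable.tsum_le_tsum hdle (Summable.of_nonneg_of_le (fun v => (hd v).nonneg) hdle hs) hs
  have hS := (hTd.sdiff_of_subset hU (by
    refine Set.iUnion_subset fun v => ?_
    rintro a ⟨⟨ha, -⟩, -⟩
    exact ha)).sdiff_zero (hasDensity_zero_of_finite Ω.finite_toSet)
  refine ⟨_, _, ?_, hS, ?_⟩
  · have h2 : (Ω.card : ℝ) / Ideal.absNorm I * ∑' v : {v // v ∉ F}, b v <
        1 / (Ideal.absNorm I : ℝ) := by
      rw [div_mul_eq_mul_div]
      exact div_lt_div_of_pos_right hF hIN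
    linarith
  · rintro a ⟨⟨haT, haE⟩, haΩ⟩
    have hclass : ∀ v ∈ F, a - c v ∈ v.asIdeal ^ 2 := by
      intro v hv
      have := Ideal.add_mem _ (hIle v hv haT) (hc₀ v hv)
      rwa [sub_add_sub_cancel] at this
    refine ⟨fun v hv => hclass v (hVF hv), fun v hv ω hω haω => ?_⟩
    by_cases hvF : v ∈ F
    · refine hc v hv ω hω ?_
      have := Ideal.sub_mem _ (hclass v hvF) haω
      rwa [sub_sub_sub_cancel_left] at this
    · have hne : {n | ∃ w ∉ F, e w = n ∧ a ∈ nearSet Ω w}.Nonempty := ⟨_, v, hvF, rfl, ω, hω, haω⟩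
      obtain ⟨w, hw, hew, haw⟩ := Nat.sInf_mem hne
      refine haE (Set.mem_iUnion.mpr ⟨⟨w, hw⟩, ⟨haT, haw, fun u hu hau => ?_⟩, haΩ⟩)
      have := Nat.sInf_le (s := {n | ∃ w ∉ F, e w = n ∧ a ∈ nearSet Ω w}) ⟨u, hu.1, rfl, hau⟩
      have huw : e u < e w := hu.2
      omega

end Sieve

end DynMono

namespace DynMono

/-! ### Maximal ideals of `R[X]` and their squares -/

section PolynomialIdeals

variable {R : Type*} [CommRing R]

theorem mem_map_C_of_map_mk_eq_zero {p : Ideal R} {g : R[X]}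
    (h : g.map (Ideal.Quotient.mk p) = 0) : g ∈ p.map (C : R →+* R[X]) := by
  rw [Ideal.mem_map_C_iff]
  intro n
  have := congrArg (fun q => q.coeff n) h
  simpa [coeff_map, Ideal.Quotient.eq_zero_iff_mem] using this

theorem map_mk_eq_zero_of_mem_map_C {p : Ideal R} {g : R[X]}
    (h : g ∈ p.map (C : R →+* R[X])) : g.map (Ideal.Quotient.mk p) = 0 := by
  rw [Ideal.mem_map_C_iff] at h
  ext n
  rw [coeff_map, coeff_zero]
  exact Ideal.Quotient.eq_zero_iff_mem.mpr (h n)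

/-- A proper ideal of `R[X]` which contains a maximal ideal `p` of `R` and a polynomial with
non-zero reduction is generated by `p` and a monic polynomial. -/
theorem exists_monic_eq_sup {p : Ideal R} [p.IsMaximal] {M : Ideal R[X]} (hM : M ≠ ⊤)
    (hp : p.map C ≤ M) {g : R[X]} (hg : g ∈ M) (hg0 : g.map (Ideal.Quotient.mk p) ≠ 0) :
    ∃ Φ : R[X], Φ.Monic ∧ 0 < Φ.natDegree ∧ M = p.map C ⊔ Ideal.span {Φ} := by
  classical
  let : Field (R ⧸ p) := Ideal.Quotient.field p
  set r : R[X] →+* (R ⧸ p)[X] := mapRingHom (Ideal.Quotient.mk p) with hr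
  have hrs : Function.Surjective r := map_surjective _ Ideal.Quotient.mk_surjective
  have hker : ∀ x y : R[X], r x = r y → x - y ∈ p.map (C : R →+* R[X]) := by
    intro x y h
    refine mem_map_C_of_map_mk_eq_zero ?_
    rw [Polynomial.map_sub]
    exact sub_eq_zero.mpr h
  obtain ⟨φ₀, hφ₀⟩ := (IsPrincipalIdealRing.principal (M.map r)).principal
  have hφ0 : φ₀ ≠ 0 := by
    rintro rfl
    have h1 : r g ∈ M.map r := Ideal.mem_map_of_mem r hg
    rw [hφ₀] at h1
    simp only [Submodule.span_zero_singleton, Submodule.mem_bot] at h1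
    exact hg0 h1
  set φ := normalize φ₀ with hφ
  have hφm : φ.Monic := monic_normalize hφ0
  have hspan : M.map r = Ideal.span {φ} := by
    rw [hφ₀, hφ]
    exact (Ideal.span_singleton_eq_span_singleton.mpr (normalize_associated φ₀)).symm
  -- The image of `M` in the principal ideal domain `(R ⧸ p)[X]` has a monic generator, which lifts
  -- to a monic polynomial of the same degree.
  obtain ⟨Φ, hΦ, hdeg, hmon⟩ := lifts_and_natDegree_eq_and_monic
    (f := Ideal.Quotient.mk p) (p := φ) (by
      obtain ⟨q, hq⟩ := hrs φ
      exact ⟨q, hq⟩) hφm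
  have hΦr : r Φ = φ := hΦ
  have hΦM : Φ ∈ M := by
    have h1 : φ ∈ M.map r := by rw [hspan]; exact Ideal.mem_span_singleton_self φ
    obtain ⟨m, hm, hmφ⟩ := (Ideal.mem_map_iff_of_surjective r hrs).mp h1
    have := hp (hker Φ m (hΦr.trans hmφ.symm))
    simpa using Ideal.add_mem _ this hm
  have hMle : M ≤ p.map C ⊔ Ideal.span {Φ} := by
    intro x hx
    have h1 : r x ∈ M.map r := Ideal.mem_map_of_mem r hx
    rw [hspan, Ideal.mem_span_singleton] at h1
    obtain ⟨w, hw⟩ := h1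
    obtain ⟨y, rfl⟩ := hrs w
    have h2 := hker x (Φ * y) (by rw [map_mul, hΦr, hw])
    rw [← sub_add_cancel x (Φ * y)]
    exact Ideal.add_mem _ (Ideal.mem_sup_left h2)
      (Ideal.mem_sup_right (Ideal.mul_mem_right _ _ (Ideal.mem_span_singleton_self Φ)))
  refine ⟨Φ, hmon, ?_, le_antisymm hMle (sup_le hp ?_)⟩
  · rw [Nat.pos_iff_ne_zero]
    intro h0
    have : Φ = 1 := hmon.natDegree_eq_zero.mp h0
    exact hM ((Ideal.eq_top_iff_one M).mpr (this ▸ hΦM))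
  · rwa [Ideal.span_singleton_le_iff_mem]

theorem sq_sup_le (I J : Ideal R) : (I ⊔ J) ^ 2 ≤ I ^ 2 ⊔ J := by
  have h1 : I * J ≤ J := Ideal.mul_le.mpr fun _ _ _ hs => J.mul_mem_left _ hs
  have h2 : J * (I ⊔ J) ≤ J := Ideal.mul_le.mpr fun _ hr _ _ => J.mul_mem_right _ hr
  rw [pow_two, pow_two, Ideal.sup_mul, Ideal.mul_sup]
  exact sup_le (sup_le le_sup_left (h1.trans le_sup_right)) (h2.trans le_sup_right)

theorem sq_sup_le' (I J : Ideal R) : (I ⊔ J) ^ 2 ≤ I ⊔ J ^ 2 := by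
  rw [sup_comm I J, sup_comm I]
  exact sq_sup_le J I

/-- Modulo `p ^ 2` the constant `c` becomes a multiple of the monic `Φ`, and such a multiple has
positive degree unless it vanishes. -/
theorem mem_sq_of_C_mem_sq {p : Ideal R} {Φ : R[X]} (hΦ : Φ.Monic) (hdeg : 0 < Φ.natDegree) {c : R}
    (hc : C c ∈ (p.map C ⊔ Ideal.span {Φ}) ^ 2) : c ∈ p ^ 2 := by
  have h1 := sq_sup_le _ _ hc
  rw [← Ideal.map_pow] at h1
  obtain ⟨z, hz, y, hy, hzy⟩ := Submodule.mem_sup.mp h1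
  obtain ⟨w, rfl⟩ := Ideal.mem_span_singleton.mp hy
  rw [← Ideal.Quotient.eq_zero_iff_mem]
  rcases subsingleton_or_nontrivial (R ⧸ p ^ 2) with hs | hn
  · exact Subsingleton.elim _ _
  have h2 := congrArg (Polynomial.map (Ideal.Quotient.mk (p ^ 2))) hzy
  rw [Polynomial.map_add, map_mk_eq_zero_of_mem_map_C hz, zero_add, Polynomial.map_mul, map_C] at h2
  set W := w.map (Ideal.Quotient.mk (p ^ 2))
  by_cases hW : W = 0
  · rw [hW, mul_zero] at h2
    exact C_eq_zero.mp h2.symm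
  · exfalso
    have h3 := congrArg natDegree h2
    rw [(hΦ.map _).natDegree_mul' hW, hΦ.natDegree_map, natDegree_C] at h3
    omega

/-- Regularity of `R[X]` at `M`: `π` and `Φ` are linearly independent in `M / M ^ 2`. Modulo `p` the
ideal `M ^ 2` is generated by `Φ ^ 2`, which forces `Φ ∣ y` there; then `x * π ∈ M ^ 2`, and
inverting `x` modulo `M` would put `π` into `M ^ 2`. -/
theorem mem_of_mul_add_mul_mem_sq {p : Ideal R} [p.IsMaximal] {M : Ideal R[X]} [M.IsMaximal]
    {Φ : R[X]} (hΦ : Φ.Monic) (hdeg : 0 < Φ.natDegree) (hM : M = p.map C ⊔ Ideal.span {Φ})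
    {π : R} (hπ : π ∈ p) (hπ2 : π ∉ p ^ 2) {x y : R[X]} (h : x * C π + y * Φ ∈ M ^ 2) :
    x ∈ M ∧ y ∈ M := by
  have hpM : p.map C ≤ M := hM ▸ le_sup_left
  have hΦM : Φ ∈ M := hM ▸ Ideal.mem_sup_right (Ideal.mem_span_singleton_self Φ)
  have hπM : C π ∈ M := hpM (Ideal.mem_map_of_mem C hπ)
  have hy : y ∈ M := by
    have h1 : x * C π + y * Φ ∈ p.map C ⊔ Ideal.span {Φ} ^ 2 := sq_sup_le' _ _ (hM ▸ h)
    rw [Ideal.span_singleton_pow] at h1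
    obtain ⟨z, hz, u, hu, hzu⟩ := Submodule.mem_sup.mp h1
    obtain ⟨w, rfl⟩ := Ideal.mem_span_singleton.mp hu
    have h2 : Φ * (y - Φ * w) ∈ p.map (C : R →+* R[X]) := by
      have : Φ * (y - Φ * w) = z - x * C π := by linear_combination hzu.symm
      rw [this]
      exact Ideal.sub_mem _ hz (Ideal.mul_mem_left _ _ (Ideal.mem_map_of_mem C hπ))
    have h3 := map_mk_eq_zero_of_mem_map_C h2
    rw [Polynomial.map_mul, mul_eq_zero, or_iff_right (hΦ.map _).ne_zero] at h3
    have h4 := Ideal.add_mem _ (hpM (mem_map_C_of_map_mk_eq_zero h3))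
      (Ideal.mul_mem_right w M hΦM)
    rwa [sub_add_cancel] at h4
  refine ⟨?_, hy⟩
  by_contra hx
  obtain ⟨x', hx'⟩ := Ideal.IsMaximal.exists_inv ‹M.IsMaximal› hx
  obtain ⟨m, hm, hxm⟩ := hx'
  have h5 : x * C π ∈ M ^ 2 := by
    have := Ideal.sub_mem _ h (by rw [pow_two]; exact Ideal.mul_mem_mul hy hΦM : y * Φ ∈ M ^ 2)
    rwa [add_sub_cancel_right] at this
  have h6 : C π ∈ M ^ 2 := by
    have h7 : C π = x' * (x * C π) + m * C π := by linear_combination (- C π) * hxm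
    rw [h7]
    refine Ideal.add_mem _ (Ideal.mul_mem_left _ _ h5) ?_
    rw [pow_two]; exact Ideal.mul_mem_mul hm hπM
  exact hπ2 (mem_sq_of_C_mem_sq hΦ hdeg (hM ▸ h6))

/-- In a Dedekind domain `p / p ^ 2` is generated by any element of `p` outside `p ^ 2`, a local
uniformizer. -/
theorem exists_le_span_sup_sq [IsDedekindDomain R] {p : Ideal R} (hp : p ≠ ⊥) [p.IsPrime] :
    ∃ π ∈ p, π ∉ p ^ 2 ∧ p ≤ Ideal.span {π} ⊔ p ^ 2 := by
  have hlt : p ^ 2 < p := by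
    have := Ideal.pow_succ_lt_pow hp 1
    simpa using this
  obtain ⟨π, hπ, hπ2⟩ := SetLike.exists_of_lt hlt
  refine ⟨π, hπ, hπ2, fun c hc => ?_⟩
  obtain ⟨d, e, he, hde⟩ := Ideal.exists_mul_add_mem_pow_succ (i := 1) hp π c (by simpa using hπ) hπ2
    (by simpa using hc)
  rw [← hde]
  exact Ideal.add_mem _ (Ideal.mem_sup_left (Ideal.mul_mem_right _ _ (Ideal.mem_span_singleton_self π)))
    (Ideal.mem_sup_right he)

theorem map_C_le_span_sup {p : Ideal R} {π : R} (h : p ≤ Ideal.span {π} ⊔ p ^ 2) :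
    p.map (C : R →+* R[X]) ≤ Ideal.span {C π} ⊔ (p.map C) ^ 2 := by
  have := Ideal.map_mono (f := (C : R →+* R[X])) h
  rwa [Ideal.map_sup, Ideal.map_span, Set.image_singleton, Ideal.map_pow] at this

/-- An element outside the square of `M = (π, Φ) + M ^ 2` is part of a system of two generators. -/
theorem exists_le_span_sup_span_sup_sq {M : Ideal R} [M.IsMaximal] {π Φ g : R}
    (hπ : π ∈ M) (hΦ : Φ ∈ M) (hM : M ≤ Ideal.span {π} ⊔ Ideal.span {Φ} ⊔ M ^ 2) (hg : g ∈ M)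
    (hg2 : g ∉ M ^ 2) : ∃ t ∈ M, M ≤ Ideal.span {g} ⊔ Ideal.span {t} ⊔ M ^ 2 := by
  have key : ∀ a b x y z : R, x ∈ M → y ∈ M → z ∈ M ^ 2 → g = a * x + b * y + z → a ∉ M →
      x ∈ Ideal.span {g} ⊔ Ideal.span {y} ⊔ M ^ 2 := by
    intro a b x y z hx hy hz hgz ha
    obtain ⟨a', m, hm, ham⟩ := Ideal.IsMaximal.exists_inv ‹M.IsMaximal› ha
    have h1 : x = (g * a' + y * (- (a' * b))) + (m * x - a' * z) := by
      linear_combination (-x) * ham - a' * hgz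
    rw [h1]
    refine Ideal.add_mem _ (Ideal.mem_sup_left (Ideal.add_mem _ (Ideal.mem_sup_left
      (Ideal.mul_mem_right _ _ (Ideal.mem_span_singleton_self g))) (Ideal.mem_sup_right
      (Ideal.mul_mem_right _ _ (Ideal.mem_span_singleton_self y))))) (Ideal.mem_sup_right ?_)
    refine Ideal.sub_mem _ ?_ (Ideal.mul_mem_left _ _ hz)
    rw [pow_two]; exact Ideal.mul_mem_mul hm hx
  obtain ⟨u, hu, z, hz, huz⟩ := Submodule.mem_sup.mp (hM hg)
  obtain ⟨v, hv, w, hw, hvw⟩ := Submodule.mem_sup.mp hu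
  obtain ⟨a, rfl⟩ := Ideal.mem_span_singleton'.mp hv
  obtain ⟨b, rfl⟩ := Ideal.mem_span_singleton'.mp hw
  have hgz : g = a * π + b * Φ + z := by rw [hvw, huz]
  by_cases ha : a ∈ M
  · by_cases hb : b ∈ M
    · refine absurd ?_ hg2
      rw [hgz]
      refine Ideal.add_mem _ (Ideal.add_mem _ ?_ ?_) hz
      · rw [pow_two]; exact Ideal.mul_mem_mul ha hπ
      · rw [pow_two]; exact Ideal.mul_mem_mul hb hΦ
    · refine ⟨π, hπ, hM.trans (sup_le (sup_le ?_ ?_) le_sup_right)⟩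
      · exact le_sup_right.trans le_sup_left
      · rw [Ideal.span_singleton_le_iff_mem]
        exact key b a Φ π z hΦ hπ hz (by rw [hgz]; ring) hb
  · refine ⟨Φ, hΦ, hM.trans (sup_le (sup_le ?_ ?_) le_sup_right)⟩
    · rw [Ideal.span_singleton_le_iff_mem]
      exact key a b π Φ z hπ hΦ hz hgz ha
    · exact le_sup_right.trans le_sup_left

/-- The derivative maps the square of an ideal of `R[X]` into the ideal. -/
theorem derivative_mem_of_mem_sq {M : Ideal R[X]} {g : R[X]} (hg : g ∈ M ^ 2) :
    derivative g ∈ M := by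
  rw [pow_two] at hg
  refine Submodule.mul_induction_on hg (fun a ha b hb => ?_) fun a b ha hb => ?_
  · rw [derivative_mul]
    exact Ideal.add_mem _ (Ideal.mul_mem_left _ _ hb) (Ideal.mul_mem_right _ _ ha)
  · rw [derivative_add]
    exact Ideal.add_mem _ ha hb

end PolynomialIdeals

end DynMono

namespace DynMono

/-! ### Dedekind's criterion in terms of `M ^ 2` -/

section DedekindCriterion

/-- Nakayama's lemma over the localization. -/
theorem isPrincipal_maximalIdeal_localization {A : Type*} [CommRing A] [IsNoetherianRing A]
    {m : Ideal A} [m.IsMaximal] {t : A} (ht : t ∈ m) (h : m ≤ Ideal.span {t} ⊔ m ^ 2) :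
    (IsLocalRing.maximalIdeal (Localization.AtPrime m)).IsPrincipal := by
  set L := Localization.AtPrime m
  have hmap : m.map (algebraMap A L) = IsLocalRing.maximalIdeal L :=
    Localization.AtPrime.map_eq_maximalIdeal
  have h1 := Ideal.map_mono (f := algebraMap A L) h
  rw [Ideal.map_sup, Ideal.map_span, Set.image_singleton, Ideal.map_pow, hmap, pow_two] at h1
  refine ⟨algebraMap A L t, le_antisymm ?_ ?_⟩
  · exact Submodule.le_of_le_smul_of_le_jacobson_bot (IsNoetherian.noetherian _)
      (IsLocalRing.maximalIdeal_le_jacobson ⊥) h1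
  · rw [Submodule.span_singleton_le_iff_mem, ← hmap]
    exact Ideal.mem_map_of_mem _ ht

/-- The characterization of discrete valuation rings, with fields allowed: for them both sides hold.
-/
theorem isPrincipal_maximalIdeal_iff (L : Type*) [CommRing L] [IsDomain L] [IsNoetherianRing L]
    [IsLocalRing L] : (IsLocalRing.maximalIdeal L).IsPrincipal ↔
      IsIntegrallyClosed L ∧ ∀ P : Ideal L, P ≠ ⊥ → P.IsPrime → P = IsLocalRing.maximalIdeal L :=
  (tfae_of_isNoetherianRing_of_isLocalRing_of_isDomain L).out 4 3

variable {R A : Type*} [CommRing R] [CommRing A] [Algebra R A]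

theorem map_mk_ne_zero_of_isUnit_leadingCoeff {p : Ideal R} (hp : p ≠ ⊤) {g : R[X]}
    (hg : IsUnit g.leadingCoeff) : g.map (Ideal.Quotient.mk p) ≠ 0 := by
  intro h
  have := congrArg (fun q => q.coeff g.natDegree) h
  simp only [coeff_map, coeff_zero, Ideal.Quotient.eq_zero_iff_mem] at this
  exact hp (Ideal.eq_top_of_isUnit_mem _ this hg)

variable [IsDedekindDomain R]

/-- The structure of a maximal ideal of `R[X]` which contracts to a maximal ideal of `R`. -/
theorem exists_generators (hR : ¬ IsField R) {M : Ideal R[X]} [M.IsMaximal]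
    [(M.comap (C : R →+* R[X])).IsMaximal] {g : R[X]} (hgM : g ∈ M) (hg : IsUnit g.leadingCoeff) :
    ∃ (π : R) (Φ : R[X]), π ∈ M.comap C ∧ π ∉ (M.comap C) ^ 2 ∧ Φ.Monic ∧ 0 < Φ.natDegree ∧
      M = (M.comap C).map C ⊔ Ideal.span {Φ} ∧
      M ≤ Ideal.span {C π} ⊔ Ideal.span {Φ} ⊔ M ^ 2 := by
  set p := M.comap (C : R →+* R[X]) with hp
  have hpmax : p.IsMaximal := inferInstance
  have hp0 : p ≠ ⊥ := Ring.ne_bot_of_isMaximal_of_not_isField hpmax hR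
  have hpM : p.map C ≤ M := Ideal.map_comap_le
  obtain ⟨π, hπ, hπ2, hle⟩ := exists_le_span_sup_sq hp0
  obtain ⟨Φ, hΦ, hdeg, hM⟩ := exists_monic_eq_sup (Ideal.IsMaximal.ne_top ‹M.IsMaximal›) hpM hgM
    (map_mk_ne_zero_of_isUnit_leadingCoeff hpmax.ne_top hg)
  refine ⟨π, Φ, hπ, hπ2, hΦ, hdeg, hM, ?_⟩
  have h1 : p.map C ≤ Ideal.span {C π} ⊔ M ^ 2 :=
    (map_C_le_span_sup hle).trans (sup_le_sup_left (Ideal.pow_right_mono hpM 2) _)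
  conv_lhs => rw [hM]
  refine sup_le (h1.trans ?_) (le_sup_right.trans le_sup_left)
  exact sup_le_sup_right le_sup_left _

variable [IsDomain A] [Algebra.IsIntegral R A] {α : A}

/-- One half of Dedekind's criterion: if `g` lies outside the square of every maximal ideal of
`R[X]`, then `R[α]` is integrally closed for a root `α` of `g`. -/
theorem isIntegrallyClosed_of_forall_notMem_sq (hR : ¬ IsField R)
    (hα : Function.Surjective (aeval α : R[X] →ₐ[R] A)) {g : R[X]} (hg : IsUnit g.leadingCoeff)
    (hgα : aeval α g = 0)
    (H : ∀ M : Ideal R[X], M.IsMaximal → (M.comap C).IsMaximal → g ∈ M → g ∉ M ^ 2) :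
    IsIntegrallyClosed A := by
  have hnoeth : IsNoetherianRing A :=
    isNoetherianRing_of_surjective R[X] A (aeval α : R[X] →ₐ[R] A).toRingHom hα
  refine IsIntegrallyClosed.of_localization_maximal fun m _ hm => ?_
  set ev : R[X] →+* A := (aeval α : R[X] →ₐ[R] A).toRingHom with hev
  have hevs : Function.Surjective ev := hα
  set M : Ideal R[X] := m.comap ev with hM
  have hMmax : M.IsMaximal := Ideal.comap_isMaximal_of_surjective ev hevs
  have hpC : M.comap C = m.comap (algebraMap R A) := by
    ext x
    simp [hM, hev, Ideal.mem_comap]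
  have hpmax : (M.comap C).IsMaximal := by
    rw [hpC]
    exact Ideal.isMaximal_comap_of_isIntegral_of_isMaximal m
  have hgM : g ∈ M := by
    rw [hM, Ideal.mem_comap]
    change aeval α g ∈ m
    rw [hgα]; exact m.zero_mem
  obtain ⟨π, Φ, hπ, -, -, -, hMeq, hle⟩ := exists_generators hR hgM hg
  have hΦM : Φ ∈ M := by
    rw [hMeq]; exact Ideal.mem_sup_right (Ideal.mem_span_singleton_self Φ)
  obtain ⟨t, ht, hle'⟩ := exists_le_span_sup_span_sup_sq (π := C π) hπ hΦM hle hgM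
    (H M hMmax hpmax hgM)
  -- Since `g` is one of two generators of `M` modulo `M ^ 2` and maps to `0`, the image of the
  -- other one generates `m` modulo `m ^ 2`.
  have hmM : M.map ev = m := Ideal.map_comap_of_surjective ev hevs m
  have h1 := Ideal.map_mono (f := ev) hle'
  have hev0 : ev g = 0 := hgα
  rw [Ideal.map_sup, Ideal.map_sup, Ideal.map_span, Ideal.map_span, Set.image_singleton,
    Set.image_singleton, hev0, Ideal.span_singleton_zero, bot_sup_eq, Ideal.map_pow, hmM] at h1
  have h2 := isPrincipal_maximalIdeal_localization (t := ev t) ht h1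
  exact ((isPrincipal_maximalIdeal_iff _).mp h2).1

/-- The other half of Dedekind's criterion: if `R[α]` is integrally closed locally at a maximal
ideal `m`, then `g` lies outside the square of the inverse image of `m`. -/
theorem notMem_sq_of_isIntegrallyClosed (hR : ¬ IsField R)
    (hα : Function.Surjective (aeval α : R[X] →ₐ[R] A)) {g : R[X]} (hg : IsUnit g.leadingCoeff)
    (hgα : ∀ q : R[X], aeval α q = 0 ↔ g ∣ q) {m : Ideal A} [m.IsMaximal]
    (hm : IsIntegrallyClosed (Localization.AtPrime m)) :
    g ∉ (m.comap (aeval α : R[X] →ₐ[R] A)) ^ 2 := by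
  intro hg2
  have hnoeth : IsNoetherianRing A :=
    isNoetherianRing_of_surjective R[X] A (aeval α : R[X] →ₐ[R] A).toRingHom hα
  set ev : R[X] →+* A := (aeval α : R[X] →ₐ[R] A).toRingHom with hev
  have hevs : Function.Surjective ev := hα
  set M : Ideal R[X] := m.comap ev with hM
  replace hg2 : g ∈ M ^ 2 := hg2
  have hMmax : M.IsMaximal := Ideal.comap_isMaximal_of_surjective ev hevs
  have hpC : M.comap C = m.comap (algebraMap R A) := by
    ext x
    simp [hM, hev, Ideal.mem_comap]
  have hpmax : (M.comap C).IsMaximal := by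
    rw [hpC]
    exact Ideal.isMaximal_comap_of_isIntegral_of_isMaximal m
  have hgM : g ∈ M := Ideal.pow_le_self two_ne_zero hg2
  obtain ⟨π, Φ, hπ, hπ2, hΦ, hdeg, hMeq, hle⟩ := exists_generators hR hgM hg
  -- The kernel of `ev` is generated by `g ∈ M ^ 2`, so the images of `π` and `Φ` stay independent;
  -- `rel` extends this to the localization by clearing denominators.
  have indep : ∀ x y : R[X], ev (x * C π + y * Φ) = 0 → x ∈ M ∧ y ∈ M := by
    intro x y hxy
    obtain ⟨q, hq⟩ := (hgα _).mp hxy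
    exact mem_of_mul_add_mul_mem_sq hΦ hdeg hMeq hπ hπ2
      (hq ▸ Ideal.mul_mem_right q (M ^ 2) hg2)
  set L := Localization.AtPrime m
  have hmap : m.map (algebraMap A L) = IsLocalRing.maximalIdeal L :=
    Localization.AtPrime.map_eq_maximalIdeal
  have hdim : Ring.DimensionLEOne A := Ring.DimensionLEOne.of_isIntegral R A
  have hdimL : Ring.DimensionLEOne L :=
    Ring.DimensionLEOne.localization L m.primeCompl_le_nonZeroDivisors
  have hprinc : (IsLocalRing.maximalIdeal L).IsPrincipal :=
    (isPrincipal_maximalIdeal_iff L).mpr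
      ⟨hm, fun P hP hP' => IsLocalRing.eq_maximalIdeal (hP'.isMaximal hP)⟩
  obtain ⟨τ, hτ⟩ := hprinc
  replace hτ : IsLocalRing.maximalIdeal L = Ideal.span {τ} := hτ
  have hinj : Function.Injective (algebraMap A L) :=
    IsLocalization.injective L m.primeCompl_le_nonZeroDivisors
  have hmM : M.map ev = m := Ideal.map_comap_of_surjective ev hevs m
  set π' := algebraMap A L (ev (C π))
  set ψ' := algebraMap A L (ev Φ)
  have hleL : IsLocalRing.maximalIdeal L ≤
      Ideal.span {π'} ⊔ Ideal.span {ψ'} ⊔ IsLocalRing.maximalIdeal L ^ 2 := by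
    have h1 := Ideal.map_mono (f := algebraMap A L) (Ideal.map_mono (f := ev) hle)
    simp only [Ideal.map_sup, Ideal.map_span, Set.image_singleton, Ideal.map_pow, hmM, hmap] at h1
    exact h1
  have hΦM : Φ ∈ M := by
    rw [hMeq]; exact Ideal.mem_sup_right (Ideal.mem_span_singleton_self Φ)
  have hmem : ∀ x ∈ M, algebraMap A L (ev x) ∈ IsLocalRing.maximalIdeal L := fun x hx => by
    rw [← hmap]; exact Ideal.mem_map_of_mem _ hx
  have hπ' : π' ∈ IsLocalRing.maximalIdeal L := hmem _ hπ
  have hψ' : ψ' ∈ IsLocalRing.maximalIdeal L := hmem _ hΦM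
  obtain ⟨u, hu⟩ := Ideal.mem_span_singleton'.mp (hτ ▸ hπ')
  obtain ⟨v, hv⟩ := Ideal.mem_span_singleton'.mp (hτ ▸ hψ')
  have rel : ∀ a b : L, a * π' + b * ψ' = 0 →
      a ∈ IsLocalRing.maximalIdeal L ∧ b ∈ IsLocalRing.maximalIdeal L := by
    intro a b hab
    obtain ⟨a₀, s, rfl⟩ := IsLocalization.exists_mk'_eq m.primeCompl a
    obtain ⟨b₀, r, rfl⟩ := IsLocalization.exists_mk'_eq m.primeCompl b
    obtain ⟨x, hx⟩ := hevs (r * a₀)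
    obtain ⟨y, hy⟩ := hevs (s * b₀)
    have h0 : ev (x * C π + y * Φ) = 0 := by
      apply hinj
      rw [map_add, map_mul, map_mul, hx, hy, map_add, map_mul, map_mul, map_mul, map_mul, map_zero]
      have h1 := IsLocalization.mk'_spec L a₀ s
      have h2 := IsLocalization.mk'_spec L b₀ r
      linear_combination (algebraMap A L r * algebraMap A L s) * hab
        - algebraMap A L r * π' * h1 - algebraMap A L s * ψ' * h2
    obtain ⟨h1, h2⟩ := indep x y h0
    have h1' : (r : A) * a₀ ∈ m := hx ▸ h1
    have h2' : (s : A) * b₀ ∈ m := hy ▸ h2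
    have h3 : a₀ ∈ m := (Ideal.IsPrime.mem_or_mem inferInstance h1').resolve_left r.2
    have h4 : b₀ ∈ m := (Ideal.IsPrime.mem_or_mem inferInstance h2').resolve_left s.2
    exact ⟨(IsLocalization.AtPrime.mk'_mem_maximal_iff L m a₀ s).mpr h3,
      (IsLocalization.AtPrime.mk'_mem_maximal_iff L m b₀ r).mpr h4⟩
  -- With a uniformizer `τ`, `π' = u * τ` and `ψ' = v * τ` satisfy `v * π' - u * ψ' = 0`, so `u` and
  -- `v` are non-units. Then the maximal ideal equals its square and is zero, so `1 * π' = 0`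
  -- contradicts `rel`.
  obtain ⟨hv1, hu1⟩ := rel v (-u) (by rw [← hu, ← hv]; ring)
  rw [neg_mem_iff] at hu1
  have hbot : IsLocalRing.maximalIdeal L = ⊥ := by
    refine Submodule.eq_bot_of_le_smul_of_le_jacobson_bot _ _ (IsNoetherian.noetherian _) ?_
      (IsLocalRing.maximalIdeal_le_jacobson ⊥)
    rw [smul_eq_mul, ← pow_two]
    refine hleL.trans (sup_le (sup_le ?_ ?_) le_rfl)
    · rw [Ideal.span_singleton_le_iff_mem, ← hu, pow_two]
      exact Ideal.mul_mem_mul hu1 (hτ ▸ Ideal.mem_span_singleton_self τ)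
    · rw [Ideal.span_singleton_le_iff_mem, ← hv, pow_two]
      exact Ideal.mul_mem_mul hv1 (hτ ▸ Ideal.mem_span_singleton_self τ)
  rw [hbot, Ideal.mem_bot] at hπ'
  have h1 := (rel 1 0 (by rw [hπ']; ring)).1
  exact (Ideal.ne_top_iff_one _).mp (IsLocalRing.maximalIdeal.isMaximal L).ne_top h1

end DedekindCriterion

end DynMono

namespace DynMono

/-! ### Integral closedness tested inside a larger field -/

section FractionField

variable {A L : Type*} [CommRing A] [IsDomain A] [Field L] [Algebra A L]

/-- `L` may exceed the fraction field of `A`; the equation with `d` places `x` in the image of that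
fraction field. -/
theorem exists_algebraMap_eq_of_isIntegral [IsIntegrallyClosed A]
    (hinj : Function.Injective (algebraMap A L)) {x : L} (hx : IsIntegral A x) {a d : A}
    (hd : d ≠ 0) (h : algebraMap A L d * x = algebraMap A L a) : ∃ c, algebraMap A L c = x := by
  let ι : FractionRing A →ₐ[A] L := IsFractionRing.liftAlgHom (g := Algebra.ofId A L) hinj
  have hd' : algebraMap A L d ≠ 0 := (map_ne_zero_iff _ hinj).mpr hd
  set y : FractionRing A := algebraMap A _ a / algebraMap A _ d with hy
  have hιy : ι y = x := by
    rw [hy, map_div₀, AlgHom.commutes, AlgHom.commutes, div_eq_iff hd', ← h, mul_comm]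
  have hyi : IsIntegral A y := by
    rw [← isIntegral_algHom_iff ι ι.toRingHom.injective, hιy]; exact hx
  obtain ⟨c, hc⟩ := IsIntegrallyClosed.algebraMap_eq_of_integral hyi
  exact ⟨c, by rw [← hιy, ← hc, AlgHom.commutes]⟩

/-- An element integral over the localization becomes integral over `A` after multiplication by some
`s ∉ m`; the hypothesis then supplies a second denominator that moves it into `A`. -/
theorem isIntegrallyClosed_localization_of_exists {m : Ideal A} [m.IsPrime]
    (hinj : Function.Injective (algebraMap A L))
    (H : ∀ x : L, IsIntegral A x → (∃ a d : A, d ≠ 0 ∧ algebraMap A L d * x = algebraMap A L a) →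
      ∃ s ∉ m, ∃ c, algebraMap A L c = algebraMap A L s * x) :
    IsIntegrallyClosed (Localization.AtPrime m) := by
  rw [isIntegrallyClosed_iff (FractionRing A)]
  intro x hx
  let ι : FractionRing A →ₐ[A] L := IsFractionRing.liftAlgHom (g := Algebra.ofId A L) hinj
  obtain ⟨s, hs⟩ := IsIntegral.exists_multiple_integral_of_isLocalization m.primeCompl x hx
  set y : FractionRing A := s • x with hy
  have hyi : IsIntegral A (ι y) := hs.map ι
  obtain ⟨a, d, hd, had⟩ := IsFractionRing.div_surjective (A := A) y
  have hd0 : d ≠ 0 := nonZeroDivisors.ne_zero hd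
  have hdF : algebraMap A (FractionRing A) d ≠ 0 :=
    (map_ne_zero_iff _ (IsFractionRing.injective A _)).mpr hd0
  obtain ⟨r, hr, c, hc⟩ := H (ι y) hyi ⟨a, d, hd0, by
    rw [← AlgHom.commutes ι d, ← map_mul, ← had, mul_div_cancel₀ _ hdF, AlgHom.commutes]⟩
  have hc' : algebraMap A (FractionRing A) c = algebraMap A _ (r * s) * x := by
    apply ι.toRingHom.injective
    change ι _ = ι _
    rw [AlgHom.commutes, hc, hy, Submonoid.smul_def, Algebra.smul_def, map_mul (algebraMap A _),
      mul_assoc, map_mul ι (algebraMap A _ r), AlgHom.commutes]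
  refine ⟨IsLocalization.mk' _ c (⟨r, hr⟩ * s), ?_⟩
  have hrs : algebraMap A (FractionRing A) (r * s) ≠ 0 := by
    refine (map_ne_zero_iff _ (IsFractionRing.injective A _)).mpr ?_
    exact mul_ne_zero (fun h => hr (h ▸ m.zero_mem)) (fun h => s.2 (h ▸ m.zero_mem))
  have h1 := congrArg (algebraMap (Localization.AtPrime m) (FractionRing A))
    (IsLocalization.mk'_spec (Localization.AtPrime m) c (⟨r, hr⟩ * s))
  rw [map_mul, ← IsScalarTower.algebraMap_apply, ← IsScalarTower.algebraMap_apply] at h1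
  rw [hc', mul_comm] at h1
  exact mul_left_cancel₀ hrs h1

end FractionField

/-! ### Monogenicity and `p`-maximality via squares of maximal ideals -/

section Criterion

variable {K : Type*} [Field K] [NumberField K]

omit [NumberField K] in
theorem isIntegral_of_aeval_eq_zero_of_isUnit {α : AlgebraicClosure K} {g : (𝓞 K)[X]}
    (hg : IsUnit g.leadingCoeff) (hα : aeval α g = 0) : IsIntegral (𝓞 K) α := by
  obtain ⟨u, hu⟩ := hg
  refine ⟨C (↑u⁻¹ : 𝓞 K) * g, ?_, ?_⟩
  · rw [Monic, leadingCoeff_mul, leadingCoeff_C, ← hu, Units.inv_mul]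
  · rw [← aeval_def, map_mul, hα, mul_zero]

/-- The minimal polynomial of `α` over 𝓞_K divides `g`; the cofactor is constant by irreducibility
over `K`, and a unit by the leading coefficient. Hence 𝓞_K[α] is 𝓞_K[X]/(g). -/
theorem aeval_eq_zero_iff_dvd {α : AlgebraicClosure K} {g : (𝓞 K)[X]}
    (hg : IsUnit g.leadingCoeff) (hirr : Irreducible (g.map (algebraMap (𝓞 K) K)))
    (hα : aeval α g = 0) (q : (𝓞 K)[X]) : aeval α q = 0 ↔ g ∣ q := by
  refine ⟨fun hq => ?_, fun ⟨w, hw⟩ => by rw [hw, map_mul, hα, zero_mul]⟩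
  have hint := isIntegral_of_aeval_eq_zero_of_isUnit hg hα
  refine dvd_trans ?_ (minpoly.isIntegrallyClosed_dvd hint hq)
  obtain ⟨w, hw⟩ := minpoly.isIntegrallyClosed_dvd hint hα
  have hunit : IsUnit w := by
    have h1 : g.map (algebraMap (𝓞 K) K) =
        (minpoly (𝓞 K) α).map (algebraMap (𝓞 K) K) * w.map (algebraMap (𝓞 K) K) := by
      rw [← Polynomial.map_mul, ← hw]
    have h2 := (hirr.isUnit_or_isUnit h1).resolve_left (by
      rw [← minpoly.isIntegrallyClosed_eq_field_fractions' K hint]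
      exact minpoly.not_isUnit K α)
    have h3 := natDegree_eq_zero_of_isUnit h2
    rw [natDegree_map_eq_of_injective RingOfIntegers.coe_injective] at h3
    rw [eq_C_of_natDegree_eq_zero h3, isUnit_C]
    have h4 : g.leadingCoeff = w.leadingCoeff := by
      rw [hw, leadingCoeff_mul, (minpoly.monic hint).leadingCoeff, one_mul]
    rw [h4, leadingCoeff, h3] at hg
    exact hg
  obtain ⟨u, rfl⟩ := hunit
  exact ⟨↑u⁻¹, by rw [hw, mul_assoc, Units.mul_inv, mul_one]⟩

/-- The generator `α` of `𝓞 K[α]`. -/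
noncomputable abbrev adjoinGen (α : AlgebraicClosure K) :
    Algebra.adjoin (𝓞 K) ({α} : Set (AlgebraicClosure K)) :=
  ⟨α, Algebra.self_mem_adjoin_singleton _ _⟩

omit [NumberField K] in
theorem coe_aeval_adjoinGen (α : AlgebraicClosure K) (q : (𝓞 K)[X]) :
    (aeval (adjoinGen α) q : AlgebraicClosure K) = aeval α q := by
  rw [← Subalgebra.coe_val, ← aeval_algHom_apply]; rfl

omit [NumberField K] in
theorem aeval_adjoinGen_surjective (α : AlgebraicClosure K) :
    Function.Surjective (aeval (adjoinGen α) : (𝓞 K)[X] →ₐ[𝓞 K] _) := by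
  rintro ⟨x, hx⟩
  rw [Algebra.adjoin_singleton_eq_range_aeval] at hx
  obtain ⟨q, hq⟩ := hx
  exact ⟨q, Subtype.ext ((coe_aeval_adjoinGen α q).trans hq)⟩

omit [NumberField K] in
theorem aeval_adjoinGen_eq_zero_iff (α : AlgebraicClosure K) (q : (𝓞 K)[X]) :
    aeval (adjoinGen α) q = 0 ↔ aeval α q = 0 := by
  rw [← coe_aeval_adjoinGen, ZeroMemClass.coe_eq_zero]

omit [NumberField K] in
theorem isIntegral_adjoin_singleton {α : AlgebraicClosure K} (hα : IsIntegral (𝓞 K) α) :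
    Algebra.IsIntegral (𝓞 K) (Algebra.adjoin (𝓞 K) ({α} : Set (AlgebraicClosure K))) :=
  Algebra.IsIntegral.adjoin fun x hx => by rw [Set.mem_singleton_iff.mp hx]; exact hα

theorem adjoin_le_integersAdjoin {α : AlgebraicClosure K} (hα : IsIntegral (𝓞 K) α) :
    Algebra.adjoin (𝓞 K) {α} ≤ integersAdjoin α := by
  rw [Algebra.adjoin_le_iff, Set.singleton_subset_iff]
  exact ⟨hα, IntermediateField.mem_adjoin_simple_self K α⟩

theorem mem_integersAdjoin_iff {α x : AlgebraicClosure K} :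
    x ∈ integersAdjoin α ↔ IsIntegral (𝓞 K) x ∧ x ∈ IntermediateField.adjoin K {α} := Iff.rfl

theorem exists_smul_mem_adjoin {α x : AlgebraicClosure K}
    (hx : x ∈ IntermediateField.adjoin K {α}) :
    ∃ d : 𝓞 K, d ≠ 0 ∧ d • x ∈ Algebra.adjoin (𝓞 K) {α} := by
  rw [← IntermediateField.mem_toSubalgebra,
    IntermediateField.adjoin_simple_toSubalgebra_of_isAlgebraic (Algebra.IsAlgebraic.isAlgebraic α),
    Algebra.adjoin_singleton_eq_range_aeval] at hx
  obtain ⟨q, rfl⟩ := hx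
  obtain ⟨d, hd, hdq⟩ := IsLocalization.integerNormalization_spec (nonZeroDivisors (𝓞 K)) q
  refine ⟨d, nonZeroDivisors.ne_zero hd, ?_⟩
  have h1 := congrArg (aeval α) hdq
  rw [aeval_map_algebraMap, ← algebraMap_smul K d q, map_smul, algebraMap_smul] at h1
  have h2 : aeval α (IsLocalization.integerNormalization (nonZeroDivisors (𝓞 K)) q) ∈
      Algebra.adjoin (𝓞 K) {α} := aeval_mem_adjoin_singleton _ _
  rw [h1] at h2
  exact h2

/-- `g` is monogenic if it lies outside the square of every maximal ideal of `𝓞 K[X]`. -/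
theorem isMonogenic_of_forall_notMem_sq {g : (𝓞 K)[X]} (hg : IsUnit g.leadingCoeff)
    (hirr : Irreducible (g.map (algebraMap (𝓞 K) K)))
    (H : ∀ M : Ideal (𝓞 K)[X], M.IsMaximal → (M.comap C).IsMaximal → g ∈ M → g ∉ M ^ 2) :
    IsMonogenic g := by
  refine ⟨hirr, fun α hα => ?_⟩
  have hint := isIntegral_of_aeval_eq_zero_of_isUnit hg hα
  refine le_antisymm (adjoin_le_integersAdjoin hint) fun x hx => ?_
  obtain ⟨hxi, hxK⟩ := mem_integersAdjoin_iff.mp hx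
  have := isIntegral_adjoin_singleton hint
  have hcl := isIntegrallyClosed_of_forall_notMem_sq (RingOfIntegers.not_isField K)
    (aeval_adjoinGen_surjective α) hg ((aeval_adjoinGen_eq_zero_iff α g).mpr hα) H
  obtain ⟨d, hd, hdx⟩ := exists_smul_mem_adjoin hxK
  obtain ⟨c, hc⟩ := exists_algebraMap_eq_of_isIntegral (L := AlgebraicClosure K)
    (A := Algebra.adjoin (𝓞 K) ({α} : Set (AlgebraicClosure K))) Subtype.val_injective
    (x := x) (hxi.tower_top) (a := ⟨d • x, hdx⟩) (d := algebraMap (𝓞 K) _ d)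
    ((map_ne_zero_iff _ (FaithfulSMul.algebraMap_injective _ _)).mpr hd) (by
      rw [← IsScalarTower.algebraMap_apply, ← Algebra.smul_def]; rfl)
  rw [← hc]
  exact c.2

omit [NumberField K] in
theorem exists_smul_mem_of_localized_eq {S : Submonoid (𝓞 K)}
    {N N' : Submodule (𝓞 K) (AlgebraicClosure K)}
    (h : Submodule.localized S N = Submodule.localized S N') {x : AlgebraicClosure K}
    (hx : x ∈ N') : ∃ s ∈ S, s • x ∈ N := by
  have h1 : LocalizedModule.mkLinearMap S (AlgebraicClosure K) x ∈ Submodule.localized S N' :=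
    ⟨x, hx, 1, IsLocalizedModule.mk'_one S _ x⟩
  rw [← h] at h1
  obtain ⟨m, hm, s, hms⟩ := h1
  rw [IsLocalizedModule.mk'_eq_iff, Submonoid.smul_def, ← map_smul,
    IsLocalizedModule.eq_iff_exists S] at hms
  obtain ⟨c, hc⟩ := hms
  refine ⟨c * s, S.mul_mem c.2 s.2, ?_⟩
  have h2 : ((c : 𝓞 K) * s) • x = (c : 𝓞 K) • m := (mul_smul _ _ _).trans hc.symm
  rw [h2]
  exact N.smul_mem _ hm

/-- If `g` is `𝔭`-maximal, then `g` lies outside the square of the maximal ideals above `𝔭`. -/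
theorem IsMaximalAt.notMem_sq {p : HeightOneSpectrum (𝓞 K)} {g : (𝓞 K)[X]}
    (h : IsMaximalAt p g) (hg : IsUnit g.leadingCoeff) {M : Ideal (𝓞 K)[X]} [M.IsMaximal]
    (hpM : p.asIdeal.map C ≤ M) (hgM : g ∈ M) : g ∉ M ^ 2 := by
  obtain ⟨hirr, hmax⟩ := h
  obtain ⟨α, hα⟩ : ∃ α : AlgebraicClosure K, aeval α g = 0 := by
    have hdeg : (g.map (algebraMap (𝓞 K) K)).degree ≠ 0 := by
      intro h0
      exact hirr.not_isUnit (isUnit_iff_degree_eq_zero.mpr h0)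
    obtain ⟨α, hα⟩ := IsAlgClosed.exists_aeval_eq_zero (AlgebraicClosure K) _ hdeg
    exact ⟨α, by rwa [aeval_map_algebraMap] at hα⟩
  have hint := isIntegral_of_aeval_eq_zero_of_isUnit hg hα
  have := isIntegral_adjoin_singleton hint
  set A := Algebra.adjoin (𝓞 K) ({α} : Set (AlgebraicClosure K)) with hA
  set ev : (𝓞 K)[X] →ₐ[𝓞 K] A := aeval (adjoinGen α) with hev
  have hevs : Function.Surjective ev := aeval_adjoinGen_surjective α
  have hker : ∀ q, ev q = 0 ↔ g ∣ q := fun q =>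
    (aeval_adjoinGen_eq_zero_iff α q).trans (aeval_eq_zero_iff_dvd hg hirr hα q)
  -- `M` contains `g`, hence the kernel of `ev`, so it corresponds to a maximal ideal of 𝓞_K[α].
  have hcomap : (M.map ev).comap ev = M := by
    refine le_antisymm (fun x hx => ?_) Ideal.le_comap_map
    obtain ⟨y, hy, hxy⟩ := (Ideal.mem_map_iff_of_surjective ev hevs).mp hx
    have h1 : ev (x - y) = 0 := by rw [map_sub, hxy, sub_self]
    obtain ⟨w, hw⟩ := (hker _).mp h1
    rw [← sub_add_cancel x y, hw]
    exact Ideal.add_mem _ (Ideal.mul_mem_right _ _ hgM) hy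
  have hmmax : (M.map ev).IsMaximal := by
    refine (Ideal.map_eq_top_or_isMaximal_of_surjective ev hevs ‹_›).resolve_left fun h => ?_
    rw [h, Ideal.comap_top] at hcomap
    exact Ideal.IsMaximal.ne_top ‹_› hcomap.symm
  have hpm : ∀ s ∈ p.asIdeal, algebraMap (𝓞 K) A s ∈ M.map ev := by
    intro s hs
    rw [← AlgHom.commutes ev s]
    exact Ideal.mem_map_of_mem ev (hpM (Ideal.mem_map_of_mem C hs))
  -- This makes denominators prime to `p` admissible in the localization at `M.map ev`.
  have hmp : ∀ s ∈ p.asIdeal.primeCompl, algebraMap (𝓞 K) A s ∉ M.map ev := by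
    intro s hs hsm
    have hpmax := p.isMaximal
    obtain ⟨r, i, hi, hri⟩ := Ideal.IsMaximal.exists_inv hpmax hs
    refine hmmax.ne_top ((Ideal.eq_top_iff_one _).mpr ?_)
    rw [← map_one (algebraMap (𝓞 K) A), ← hri, map_add, map_mul]
    exact Ideal.add_mem _ (Ideal.mul_mem_left _ _ hsm) (hpm i hi)
  have hcl : IsIntegrallyClosed (Localization.AtPrime (M.map ev)) := by
    refine isIntegrallyClosed_localization_of_exists (L := AlgebraicClosure K)
      Subtype.val_injective fun x hx hxa => ?_
    obtain ⟨a, d, hd, had⟩ := hxa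
    have hAK : ∀ z : A, (z : AlgebraicClosure K) ∈ IntermediateField.adjoin K {α} := fun z =>
      (mem_integersAdjoin_iff.mp (adjoin_le_integersAdjoin hint z.2)).2
    have hd0 : (d : AlgebraicClosure K) ≠ 0 := fun h => hd (Subtype.ext h)
    have hxmem : x ∈ integersAdjoin α := by
      refine mem_integersAdjoin_iff.mpr ⟨isIntegral_trans x hx, ?_⟩
      have : x = (a : AlgebraicClosure K) / d := by
        rw [eq_div_iff hd0, mul_comm]; exact had
      rw [this]
      exact div_mem (hAK a) (hAK d)
    obtain ⟨s, hs, hsx⟩ := exists_smul_mem_of_localized_eq (hmax α hα) hxmem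
    refine ⟨algebraMap (𝓞 K) A s, hmp s hs, ⟨s • x, hsx⟩, ?_⟩
    rw [← IsScalarTower.algebraMap_apply, ← Algebra.smul_def]
    rfl
  have := notMem_sq_of_isIntegrallyClosed (RingOfIntegers.not_isField K) hevs hg hker hcl
  rwa [hcomap] at this

theorem IsMonogenic.isMaximalAt {g : (𝓞 K)[X]} (h : IsMonogenic g)
    (p : HeightOneSpectrum (𝓞 K)) : IsMaximalAt p g :=
  ⟨h.1, fun α hα => by rw [h.2 α hα]⟩

end Criterion

end DynMono

namespace DynMono

/-! ### Iterates of a polynomial -/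

section Iterates

variable {R : Type*} [CommRing R]

theorem iter_zero (f : R[X]) : iter f 0 = X := rfl

theorem iter_succ (f : R[X]) (n : ℕ) : iter f (n + 1) = f.comp (iter f n) :=
  Function.iterate_succ_apply' _ _ _

theorem iter_one (f : R[X]) : iter f 1 = f := by rw [iter_succ, iter_zero, comp_X]

theorem iter_add (f : R[X]) (m n : ℕ) : iter f (m + n) = (iter f m).comp (iter f n) := by
  induction m with
  | zero => rw [zero_add, iter_zero, X_comp]
  | succ m ih => rw [Nat.succ_add, iter_succ, iter_succ, ih, comp_assoc]

theorem iter_succ' (f : R[X]) (n : ℕ) : iter f (n + 1) = (iter f n).comp f := by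
  rw [iter_add, iter_one]

theorem derivative_dvd_derivative_iter (f : R[X]) (n : ℕ) :
    derivative f ∣ derivative (iter f (n + 1)) := by
  rw [iter_succ', derivative_comp]
  exact dvd_mul_right _ _

/-- By the chain rule the derivative of `fⁿ` is the product of the `f' ∘ fⁱ` with `i < n`. -/
theorem exists_derivative_comp_mem {f : R[X]} {M : Ideal R[X]} [M.IsPrime] {n : ℕ}
    (h : derivative (iter f n) ∈ M) : ∃ i < n, (derivative f).comp (iter f i) ∈ M := by
  induction n with
  | zero =>
    rw [iter_zero, derivative_X] at h
    exact absurd ((Ideal.eq_top_iff_one M).mpr h) (Ideal.IsPrime.ne_top ‹_›)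
  | succ n ih =>
    rw [iter_succ, derivative_comp] at h
    rcases Ideal.IsPrime.mem_or_mem ‹_› h with h | h
    · obtain ⟨i, hi, hM⟩ := ih h
      exact ⟨i, by omega, hM⟩
    · exact ⟨n, by omega, h⟩

variable [IsDomain R]

theorem natDegree_iter (f : R[X]) (n : ℕ) : (iter f n).natDegree = f.natDegree ^ n := by
  induction n with
  | zero => rw [iter_zero, natDegree_X, pow_zero]
  | succ n ih => rw [iter_succ, natDegree_comp, ih, pow_succ']

theorem isUnit_leadingCoeff_iter {f : R[X]} (hf : IsUnit f.leadingCoeff) (hd : 0 < f.natDegree)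
    (n : ℕ) : IsUnit (iter f n).leadingCoeff := by
  induction n with
  | zero => rw [iter_zero, leadingCoeff_X]; exact isUnit_one
  | succ n ih =>
    rw [iter_succ, leadingCoeff_comp (by rw [natDegree_iter]; positivity)]
    exact hf.mul (ih.pow _)

theorem isUnit_leadingCoeff_iter_sub_C {f : R[X]} (hf : IsUnit f.leadingCoeff)
    (hd : 0 < f.natDegree) (n : ℕ) (a : R) : IsUnit (iter f n - C a).leadingCoeff := by
  rw [leadingCoeff_sub_of_degree_lt]
  · exact isUnit_leadingCoeff_iter hf hd n
  · refine degree_C_le.trans_lt ?_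
    rw [← natDegree_pos_iff_degree_pos, natDegree_iter]
    positivity

theorem isUnit_leadingCoeff_sub_C {f : R[X]} (hf : IsUnit f.leadingCoeff)
    (hd : 0 < f.natDegree) (a : R) : IsUnit (f - C a).leadingCoeff := by
  have := isUnit_leadingCoeff_iter_sub_C hf hd 1 a
  rwa [iter_one] at this

end Iterates

/-! ### Critical points, their orbits, and vanishing primes -/

section CriticalPoints

variable {K : Type*} [Field K] [NumberField K] {f : (𝓞 K)[X]}

theorem derivative_ne_zero_of_natDegree_pos (hd : 0 < f.natDegree) : derivative f ≠ 0 := by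
  rw [Ne, derivative_eq_zero]
  exact hd.ne'

/-- A finite orbit gives `fⁱ(θ) = fʲ(θ)` with `i < j`, and `fʲ - fⁱ` has unit leading coefficient
once `f` has degree at least two. In degree one there are no critical points. -/
theorem IsCriticalPoint.isIntegral {θ : AlgebraicClosure K} (hθ : IsCriticalPoint f θ)
    (hlead : IsUnit f.leadingCoeff) (hd : 0 < f.natDegree) (hpcf : IsPCF f) :
    IsIntegral (𝓞 K) θ := by
  have hd2 : 1 < f.natDegree := by
    by_contra h
    have h1 : f.natDegree = 1 := by omega
    have h2 : derivative f = C (f.coeff 1) := by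
      conv_lhs => rw [eq_X_add_C_of_natDegree_le_one h1.le]
      simp
    rw [IsCriticalPoint, h2, aeval_C,
      map_eq_zero_iff _ (FaithfulSMul.algebraMap_injective (𝓞 K) (AlgebraicClosure K))] at hθ
    rw [leadingCoeff, h1, hθ] at hlead
    exact not_isUnit_zero hlead
  have hni : ¬ Function.Injective fun n : ℕ => aeval θ (iter f n) := fun h =>
    Set.infinite_range_of_injective h (hpcf θ hθ)
  have key : ∀ i j, i < j → aeval θ (iter f i) = aeval θ (iter f j) → IsIntegral (𝓞 K) θ := by
    intro i j hij h
    refine isIntegral_of_aeval_eq_zero_of_isUnit (g := iter f j - iter f i) ?_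
      (by rw [map_sub, h, sub_self])
    rw [leadingCoeff_sub_of_degree_lt]
    · exact isUnit_leadingCoeff_iter hlead hd j
    · apply degree_lt_degree
      rw [natDegree_iter, natDegree_iter]
      exact Nat.pow_lt_pow_right hd2 hij
  rw [Function.Injective] at hni
  push Not at hni
  obtain ⟨i, j, hij, hne⟩ := hni
  rcases lt_or_gt_of_ne hne with h | h
  exacts [key i j h hij, key j i h hij.symm]

/-- The iterates of a critical point are algebraic integers of `K`. -/
theorem IsCriticalPoint.exists_aeval_iter {θ : AlgebraicClosure K} (hθ : IsCriticalPoint f θ)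
    (hlead : IsUnit f.leadingCoeff) (hd : 0 < f.natDegree) (hpcf : IsPCF f)
    (hrat : HasRationalCriticalValues f) (n : ℕ) :
    ∃ b : 𝓞 K, algebraMap (𝓞 K) (AlgebraicClosure K) b = aeval θ (iter f (n + 1)) ∧
      (b : K) ∈ postcriticalSet f := by
  obtain ⟨c, hc⟩ := hrat θ hθ
  have hint := hθ.isIntegral hlead hd hpcf
  have hci : IsIntegral (𝓞 K) c := by
    rw [← isIntegral_algebraMap_iff (B := AlgebraicClosure K)
      (algebraMap K (AlgebraicClosure K)).injective, hc]
    exact (integralClosure (𝓞 K) (AlgebraicClosure K)).aeval_coe ⟨θ, hint⟩ f ▸ Subtype.property _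
  obtain ⟨b, rfl⟩ := IsIntegrallyClosed.algebraMap_eq_of_integral hci
  rw [← IsScalarTower.algebraMap_apply] at hc
  have h1 : algebraMap (𝓞 K) (AlgebraicClosure K) ((iter f n).eval b) =
      aeval θ (iter f (n + 1)) := by
    rw [iter_succ', aeval_comp, ← hc, aeval_algebraMap_apply, coe_aeval_eq_eval]
  exact ⟨_, h1, θ, hθ, n + 1, by omega, by
    rw [← h1, IsScalarTower.algebraMap_apply (𝓞 K) K (AlgebraicClosure K)]⟩

/-- At a critical point, `fⁿ` takes its value with multiplicity at least two. -/
theorem IsCriticalPoint.sq_minpoly_dvd {θ : AlgebraicClosure K} (hθ : IsCriticalPoint f θ)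
    (hint : IsIntegral (𝓞 K) θ) {n : ℕ} {b : 𝓞 K}
    (hb : algebraMap (𝓞 K) (AlgebraicClosure K) b = aeval θ (iter f (n + 1))) :
    minpoly (𝓞 K) θ ^ 2 ∣ iter f (n + 1) - C b := by
  set h := minpoly (𝓞 K) θ with hh
  have h0 : aeval θ (iter f (n + 1) - C b) = 0 := by rw [map_sub, aeval_C, hb, sub_self]
  obtain ⟨q, hq⟩ := minpoly.isIntegrallyClosed_dvd hint h0
  have h1 : aeval θ (derivative (iter f (n + 1) - C b)) = 0 := by
    rw [derivative_sub, derivative_C, sub_zero]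
    obtain ⟨w, hw⟩ := derivative_dvd_derivative_iter f n
    have : aeval θ (derivative f) = 0 := hθ
    rw [hw, map_mul, this, zero_mul]
  rw [hq, derivative_mul, map_add, map_mul, map_mul, minpoly.aeval, zero_mul, add_zero,
    mul_eq_zero] at h1
  -- Separability: `h'` is non-zero of smaller degree than the minimal polynomial `h`. So the
  -- cofactor `q` vanishes at `θ` too.
  have h2 : aeval θ (derivative h) ≠ 0 := by
    intro h3
    have hpos : 0 < h.natDegree := minpoly.natDegree_pos hint
    refine (minpoly.monic hint).not_dvd_of_natDegree_lt
      (derivative_ne_zero_of_natDegree_pos hpos) (natDegree_derivative_lt hpos.ne')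
      (minpoly.isIntegrallyClosed_dvd hint h3)
  obtain ⟨w, hw⟩ := minpoly.isIntegrallyClosed_dvd hint (h1.resolve_left h2)
  exact ⟨w, by rw [hq, hw, pow_two, mul_assoc]⟩

theorem finite_setOf_isCriticalPoint (hd : 0 < f.natDegree) : {θ | IsCriticalPoint f θ}.Finite := by
  have h := (derivative f).rootSet_finite (AlgebraicClosure K)
  refine h.subset fun θ hθ => ?_
  rw [mem_rootSet]
  exact ⟨derivative_ne_zero_of_natDegree_pos hd, hθ⟩

theorem finite_setOf_mem_postcriticalSet (hd : 0 < f.natDegree) (hpcf : IsPCF f) :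
    {b : 𝓞 K | (b : K) ∈ postcriticalSet f}.Finite := by
  have h := (finite_setOf_isCriticalPoint hd).biUnion hpcf
  refine (h.preimage (FaithfulSMul.algebraMap_injective (𝓞 K) (AlgebraicClosure K)).injOn).subset ?_
  rintro b ⟨θ, hθ, n, -, hn⟩
  exact Set.mem_biUnion hθ ⟨n, hn.symm⟩

/-- Up to its leading coefficient, `f'` is monic and divides a product of minimal polynomials of
critical points. -/
theorem exists_minpoly_mem_of_derivative_mem (hlead : IsUnit f.leadingCoeff) (hd : 0 < f.natDegree)
    (hpcf : IsPCF f) {p : HeightOneSpectrum (𝓞 K)} (hp : ¬ IsVanishing f p)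
    {N : Ideal (𝓞 K)[X]} [N.IsPrime] (hN : N.comap C = p.asIdeal) (h : derivative f ∈ N) :
    ∃ θ, IsCriticalPoint f θ ∧ minpoly (𝓞 K) θ ∈ N := by
  set D := derivative f with hD
  have hD0 : D ≠ 0 := derivative_ne_zero_of_natDegree_pos hd
  set ι := algebraMap (𝓞 K) (AlgebraicClosure K)
  have hιinj : Function.Injective ι := FaithfulSMul.algebraMap_injective _ _
  set s := (D.map ι).roots with hs
  have hcrit : ∀ θ ∈ s, IsCriticalPoint f θ := by
    intro θ hθ
    have := (mem_roots'.mp hθ).2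
    rwa [IsRoot, eval_map_algebraMap] at this
  have hint : ∀ θ ∈ s, IsIntegral (𝓞 K) θ := fun θ hθ =>
    (hcrit θ hθ).isIntegral hlead hd hpcf
  set P : (𝓞 K)[X] := (s.map (minpoly (𝓞 K))).prod with hP
  have hPm : P.Monic := monic_multiset_prod_of_monic s _ fun θ hθ => minpoly.monic (hint θ hθ)
  have hdvd : D.map (algebraMap (𝓞 K) K) ∣ P.map (algebraMap (𝓞 K) K) := by
    rw [← map_dvd_map' (algebraMap K (AlgebraicClosure K)), map_map, map_map,
      ← IsScalarTower.algebraMap_eq]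
    rw [(IsAlgClosed.splits (D.map ι)).eq_prod_roots]
    have hc : IsUnit (C (D.map ι).leadingCoeff) := by
      rw [isUnit_C, isUnit_iff_ne_zero]
      exact leadingCoeff_ne_zero.mpr ((Polynomial.map_ne_zero_iff hιinj).mpr hD0)
    rw [hc.mul_left_dvd, hP, Polynomial.map_multiset_prod, Multiset.map_map]
    refine Multiset.prod_dvd_prod_of_dvd _ _ fun θ hθ => ?_
    rw [dvd_iff_isRoot, IsRoot, Function.comp_apply, eval_map_algebraMap, minpoly.aeval]
  -- By Gauss's lemma, `f'` is its leading coefficient times a monic `g` over 𝓞_K. Thus `p` being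
  -- non-vanishing means that this coefficient is outside `p`, and `f' ∈ N` forces `g ∈ N`.
  obtain ⟨g, hg⟩ := IsIntegrallyClosed.eq_map_mul_C_of_dvd K hPm hdvd
  have hgD : g * C D.leadingCoeff = D := by
    apply map_injective (algebraMap (𝓞 K) K) RingOfIntegers.coe_injective
    rw [Polynomial.map_mul, map_C, ← leadingCoeff_map_of_injective RingOfIntegers.coe_injective, hg]
  have hgm : g.Monic := by
    have := congrArg leadingCoeff hgD
    rw [leadingCoeff_mul, leadingCoeff_C] at this
    exact mul_eq_right₀ (leadingCoeff_ne_zero.mpr hD0) |>.mp this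
  have hgP : g ∣ P := by
    rw [← map_dvd_map _ RingOfIntegers.coe_injective hgm]
    exact (Dvd.intro _ hg).trans hdvd
  have hc : C D.leadingCoeff ∉ N := by
    intro hc
    have hc' : D.leadingCoeff ∈ p.asIdeal := hN ▸ hc
    refine hp ?_
    rw [IsVanishing, red, ← hD, ← hgD, Polynomial.map_mul, map_C,
      Ideal.Quotient.eq_zero_iff_mem.mpr hc', C_0, mul_zero]
  have hgN : g ∈ N := by
    rw [← hgD] at h
    exact (Ideal.IsPrime.mem_or_mem ‹N.IsPrime› h).resolve_right hc
  have hPN : P ∈ N := N.mem_of_dvd hgP hgN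
  obtain ⟨_, hq, hqN⟩ := (Ideal.IsPrime.multiset_prod_mem_iff_exists_mem ‹N.IsPrime› _).mp hPN
  obtain ⟨θ, hθ, rfl⟩ := Multiset.mem_map.mp hq
  exact ⟨θ, hcrit θ hθ, hqN⟩

/-- Such primes divide the leading coefficient of `f'`. -/
theorem finite_setOf_isVanishing (hd : 0 < f.natDegree) : {p | IsVanishing f p}.Finite := by
  have h0 : (derivative f).leadingCoeff ≠ 0 :=
    leadingCoeff_ne_zero.mpr (derivative_ne_zero_of_natDegree_pos hd)
  refine (Ideal.finite_factors (I := Ideal.span {(derivative f).leadingCoeff})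
    (by simpa using h0)).subset fun p hp => ?_
  rw [Set.mem_ofPred_eq, Ideal.dvd_span_singleton]
  have := congrArg (fun q => q.coeff (derivative f).natDegree) hp
  simp only [red, coeff_map, coeff_zero, Ideal.Quotient.eq_zero_iff_mem] at this
  exact this

end CriticalPoints

end DynMono

namespace DynMono

/-! ### Composition when the derivative vanishes modulo `p` -/

section Composition

variable {R : Type*} [CommRing R]

theorem comp_mem_map_C {p : Ideal R} {w : R[X]} (h : w ∈ p.map (C : R →+* R[X])) (s : R[X]) :
    w.comp s ∈ p.map (C : R →+* R[X]) := by
  have h1 := Ideal.mem_map_of_mem (compRingHom s) h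
  have h2 : (compRingHom s).comp (C : R →+* R[X]) = C := by
    ext x
    simp
  rwa [Ideal.map_map, h2, coe_compRingHom_apply] at h1

theorem C_mem_comap_compRingHom {M : Ideal R[X]} {s : R[X]} {c : R} :
    C c ∈ M.comap (compRingHom s) ↔ C c ∈ M := by
  rw [Ideal.mem_comap, coe_compRingHom_apply, C_comp]

/-- A polynomial over a finite field of characteristic `ℓ` whose derivative vanishes is an `ℓ`-th
power. -/
theorem exists_pow_eq_of_derivative_eq_zero {k : Type*} [Field k] [Finite k] {g : k[X]}
    (hg : derivative g = 0) : ∃ (ℓ : ℕ) (u : k[X]), 2 ≤ ℓ ∧ g = u ^ ℓ := by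
  obtain ⟨ℓ, hℓ⟩ := CharP.exists k
  have hprime : ℓ.Prime := CharP.char_is_prime k ℓ
  have : Fact ℓ.Prime := ⟨hprime⟩
  exact ⟨ℓ, _, hprime.two_le, by
    rw [← polynomial_expand_eq, expand_contract ℓ hg hprime.ne_zero]⟩

/-- If `g' ≡ 0 mod p` and `g ∘ s` lies in the square of a maximal ideal of `R[X]` above `p`, then
`g` itself lies in the square of such an ideal. -/
theorem exists_mem_sq_of_comp_mem_sq [IsDedekindDomain R] {p : Ideal R} [p.IsMaximal]
    [Finite (R ⧸ p)] (hp0 : p ≠ ⊥) {g s : R[X]}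
    (hg : (derivative g).map (Ideal.Quotient.mk p) = 0) {M : Ideal R[X]} [M.IsMaximal]
    (hM : M.comap C = p) {t : R[X]} (ht : t ∈ M) (ht0 : t.map (Ideal.Quotient.mk p) ≠ 0)
    (h : g.comp s ∈ M ^ 2) :
    ∃ N : Ideal R[X], N.IsMaximal ∧ p.map C ≤ N ∧ g ∈ N ^ 2 := by
  let : Field (R ⧸ p) := Ideal.Quotient.field p
  have hpM : p.map C ≤ M := hM ▸ Ideal.map_comap_le
  obtain ⟨π, hπ, hπ2, hle⟩ := exists_le_span_sup_sq hp0
  obtain ⟨Φ, hΦ, hdeg, hMeq⟩ := exists_monic_eq_sup (Ideal.IsMaximal.ne_top ‹M.IsMaximal›) hpM ht ht0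
  -- This leads to `g = U ^ ℓ + V * π + w₂` with `w₂` in the square of `p.map C`. As `ℓ ≥ 2`,
  -- membership of such a `g` in the square of an ideal above `p` follows from `U` and `V` lying in
  -- the ideal.
  obtain ⟨ℓ, u, hℓ, hu⟩ := exists_pow_eq_of_derivative_eq_zero
    (g := g.map (Ideal.Quotient.mk p)) (by rw [derivative_map, hg])
  obtain ⟨U, rfl⟩ := map_surjective _ Ideal.Quotient.mk_surjective u
  have hw : g - U ^ ℓ ∈ p.map (C : R →+* R[X]) := mem_map_C_of_map_mk_eq_zero (by
    rw [Polynomial.map_sub, Polynomial.map_pow, hu, sub_self])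
  obtain ⟨w₁, hw₁, w₂, hw₂, hww⟩ := Submodule.mem_sup.mp (map_C_le_span_sup hle hw)
  obtain ⟨V, rfl⟩ := Ideal.mem_span_singleton'.mp hw₁
  have hpow : ∀ {I : Ideal R[X]} {x : R[X]}, x ∈ I → x ^ ℓ ∈ I ^ 2 := fun hx =>
    Ideal.pow_le_pow_right hℓ (Ideal.pow_mem_pow hx ℓ)
  have hUM : U.comp s ∈ M := by
    refine Ideal.IsPrime.mem_of_pow_mem inferInstance ℓ ?_
    have h1 := Ideal.sub_mem _ (Ideal.pow_le_self two_ne_zero h) (hpM (comp_mem_map_C hw s))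
    rwa [sub_comp, sub_sub_cancel, pow_comp] at h1
  have hpM2 : (p.map (C : R →+* R[X])) ^ 2 ≤ M ^ 2 := Ideal.pow_right_mono hpM 2
  have hw₂M : w₂.comp s ∈ M ^ 2 := hpM2 (by
    rw [← Ideal.map_pow] at hw₂ ⊢
    exact comp_mem_map_C hw₂ s)
  have hVM : V.comp s ∈ M := by
    refine (mem_of_mul_add_mul_mem_sq hΦ hdeg hMeq hπ hπ2 (y := 0) ?_).1
    have h1 := congrArg (fun q => q.comp s) hww
    simp only [add_comp, mul_comp, C_comp, sub_comp, pow_comp] at h1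
    have h2 : V.comp s * C π + 0 * Φ = g.comp s - (U.comp s) ^ ℓ - w₂.comp s := by
      linear_combination h1
    rw [h2]
    exact Ideal.sub_mem _ (Ideal.sub_mem _ h (hpow hUM)) hw₂M
  -- The preimage of `M` under `X ↦ s` contains `U` and `V`. It is a proper ideal and is enlarged to
  -- a maximal one at the end.
  set N := M.comap (compRingHom s) with hN
  have hpN : p.map C ≤ N := by
    rw [Ideal.map_le_iff_le_comap]
    exact fun c hc => C_mem_comap_compRingHom.mpr (hpM (Ideal.mem_map_of_mem C hc))
  have hUN : U ∈ N := by rwa [hN, Ideal.mem_comap, coe_compRingHom_apply]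
  have hVN : V ∈ N := by rwa [hN, Ideal.mem_comap, coe_compRingHom_apply]
  have hgN : g ∈ N ^ 2 := by
    rw [← sub_add_cancel g (U ^ ℓ), ← hww]
    refine Ideal.add_mem _ (Ideal.add_mem _ ?_ (Ideal.pow_right_mono hpN 2 hw₂)) (hpow hUN)
    rw [pow_two]
    exact Ideal.mul_mem_mul hVN (hpN (Ideal.mem_map_of_mem C hπ))
  obtain ⟨N', hN', hle'⟩ := Ideal.exists_le_maximal N (Ideal.IsPrime.ne_top inferInstance)
  exact ⟨N', hN', hpN.trans hle', Ideal.pow_right_mono hle' 2 hgN⟩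

end Composition

/-! ### The local conditions at vanishing and non-vanishing primes -/

section Local

variable {K : Type*} [Field K] [NumberField K] {f : (𝓞 K)[X]} {p : HeightOneSpectrum (𝓞 K)}
  {M : Ideal (𝓞 K)[X]}

omit [NumberField K] in
theorem C_mem_sq_of_mem_sq (hM : M.comap C = p.asIdeal) {c : 𝓞 K} (hc : c ∈ p.asIdeal ^ 2) :
    C c ∈ M ^ 2 := by
  have h1 : p.asIdeal.map C ≤ M := hM ▸ Ideal.map_comap_le
  have h2 := Ideal.mem_map_of_mem (C : 𝓞 K →+* (𝓞 K)[X]) hc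
  rw [Ideal.map_pow] at h2
  exact Ideal.pow_right_mono h1 2 h2

/-- Modulo `M ^ 2` the polynomial is `(f - a) ∘ fᵐ`, because `b - a ∈ p ^ 2`; an obstruction then
descends to `f - a` itself. -/
theorem iter_sub_C_notMem_sq_of_isVanishing (hlead : IsUnit f.leadingCoeff) (hd : 0 < f.natDegree)
    (hp : IsVanishing f p) {a b : 𝓞 K} (ha : IsMaximalAt p (f - C a))
    (hab : b - a ∈ p.asIdeal ^ 2) [M.IsMaximal] (hM : M.comap C = p.asIdeal) (m : ℕ) :
    iter f (m + 1) - C b ∉ M ^ 2 := by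
  intro h
  have hmax : p.asIdeal.IsMaximal := p.isMaximal
  have hfin : Finite (𝓞 K ⧸ p.asIdeal) := Ideal.finiteQuotientOfFreeOfNeBot _ p.ne_bot
  have h1 : (f - C a).comp (iter f m) ∈ M ^ 2 := by
    have := Ideal.add_mem _ h (C_mem_sq_of_mem_sq hM hab)
    rw [sub_comp, C_comp]
    rwa [C_sub, sub_add_sub_cancel, iter_succ] at this
  obtain ⟨N, hN, hpN, hfN⟩ := exists_mem_sq_of_comp_mem_sq p.ne_bot (g := f - C a)
    (by rw [derivative_sub, derivative_C, sub_zero]; exact hp) hM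
    (Ideal.pow_le_self two_ne_zero h)
    (map_mk_ne_zero_of_isUnit_leadingCoeff hmax.ne_top
      (isUnit_leadingCoeff_iter_sub_C hlead hd (m + 1) b)) h1
  exact ha.notMem_sq (isUnit_leadingCoeff_sub_C hlead hd a) hpN
    (Ideal.pow_le_self two_ne_zero hfN) hfN

/-- If `fⁿ - a ∈ M ^ 2`, differentiation produces a critical point whose minimal polynomial,
composed with `fⁱ`, lies in `M`. Its square divides `fⁿ - b` for a postcritical `b`, and subtracting
leaves the constant `a - b` in `M ^ 2`. -/
theorem iter_sub_C_notMem_sq_of_not_isVanishing (hlead : IsUnit f.leadingCoeff)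
    (hd : 0 < f.natDegree) (hpcf : IsPCF f) (hrat : HasRationalCriticalValues f)
    (hp : ¬ IsVanishing f p) {a : 𝓞 K}
    (ha : ∀ b : 𝓞 K, (b : K) ∈ postcriticalSet f → a - b ∉ p.asIdeal ^ 2) [M.IsMaximal]
    (hM : M.comap C = p.asIdeal) (n : ℕ) : iter f n - C a ∉ M ^ 2 := by
  intro h
  have hmax : (M.comap (C : 𝓞 K →+* (𝓞 K)[X])).IsMaximal := hM ▸ p.isMaximal
  have h1 := derivative_mem_of_mem_sq h
  rw [derivative_sub, derivative_C, sub_zero] at h1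
  obtain ⟨i, hi, h2⟩ := exists_derivative_comp_mem h1
  -- After `fⁱ` has hit a critical point modulo `M`, at least one application of `f` remains, so the
  -- value `b` is in `Ω`.
  obtain ⟨k, rfl⟩ : ∃ k, n = (k + 1) + i := ⟨n - i - 1, by omega⟩
  obtain ⟨θ, hθ, h3⟩ := exists_minpoly_mem_of_derivative_mem hlead hd hpcf hp
    (N := M.comap (compRingHom (iter f i))) (by
      rw [← hM]
      ext c
      exact C_mem_comap_compRingHom)
    (by rwa [Ideal.mem_comap, coe_compRingHom_apply])
  rw [Ideal.mem_comap, coe_compRingHom_apply] at h3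
  obtain ⟨b, hb, hbΩ⟩ := hθ.exists_aeval_iter hlead hd hpcf hrat k
  obtain ⟨q, hq⟩ := hθ.sq_minpoly_dvd (hθ.isIntegral hlead hd hpcf) hb
  have h4 : iter f (k + 1 + i) - C b ∈ M ^ 2 := by
    have := congrArg (fun q => q.comp (iter f i)) hq
    simp only [sub_comp, C_comp, mul_comp, pow_comp, ← iter_add] at this
    rw [this]
    exact Ideal.mul_mem_right _ _ (Ideal.pow_mem_pow h3 2)
  have h5 : C (a - b) ∈ M ^ 2 := by
    have := Ideal.sub_mem _ h4 h
    rwa [sub_sub_sub_cancel_left, ← C_sub] at this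
  obtain ⟨π, Φ, -, -, hΦ, hdeg, hMeq, -⟩ := exists_generators (RingOfIntegers.not_isField K)
    (Ideal.pow_le_self two_ne_zero h) (isUnit_leadingCoeff_iter_sub_C hlead hd (k + 1 + i) a)
  refine ha b hbΩ (mem_sq_of_C_mem_sq hΦ hdeg ?_)
  rwa [← hM, ← hMeq]

omit [NumberField K] in
theorem natDegree_pos_of_irreducible_sub_C {a : 𝓞 K}
    (h : Irreducible ((iter f 1 - C a).map (algebraMap (𝓞 K) K))) : 0 < f.natDegree := by
  rw [iter_one] at h
  by_contra h0
  rw [eq_C_of_natDegree_eq_zero (by omega : f.natDegree = 0), ← C_sub, map_C] at h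
  have := natDegree_pos_iff_degree_pos.mpr (degree_pos_of_irreducible h)
  rw [natDegree_C] at this
  exact this.ne rfl

end Local

/-! ### Assembling the two implications -/

section Global

variable {K : Type*} [Field K] [NumberField K] {f : (𝓞 K)[X]}

theorem isDynMonogenic_of_forall_notMem_sq (hlead : IsUnit f.leadingCoeff) (hd : 0 < f.natDegree)
    {a : 𝓞 K} (ha : IsDynIrreducible f a)
    (H : ∀ (p : HeightOneSpectrum (𝓞 K)) (M : Ideal (𝓞 K)[X]), M.IsMaximal →
      M.comap C = p.asIdeal → ∀ n, iter f (n + 1) - C a ∉ M ^ 2) : IsDynMonogenic f a := by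
  intro n hn
  obtain ⟨m, rfl⟩ : ∃ m, n = m + 1 := ⟨n - 1, by omega⟩
  refine isMonogenic_of_forall_notMem_sq (isUnit_leadingCoeff_iter_sub_C hlead hd _ a)
    (ha _ hn) fun M hM hp _ => ?_
  exact H ⟨M.comap C, hp.isPrime,
    Ring.ne_bot_of_isMaximal_of_not_isField hp (RingOfIntegers.not_isField K)⟩ M hM rfl m

theorem exists_hasDensity_isDynMonogenic (hlead : IsUnit f.leadingCoeff) (hpcf : IsPCF f)
    (hrat : HasRationalCriticalValues f) {Z : Set (𝓞 K)} (hZ : HasDensity Z 0)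
    (hirr : ∀ a : 𝓞 K, a ∉ Z → IsDynIrreducible f a)
    (h1 : ∀ p : HeightOneSpectrum (𝓞 K), ¬ IsVanishing f p →
      ∃ c : 𝓞 K ⧸ p.asIdeal ^ 2, ∀ b : 𝓞 K, (b : K) ∈ postcriticalSet f →
        Ideal.Quotient.mk (p.asIdeal ^ 2) b ≠ c)
    (h2 : ∀ p : HeightOneSpectrum (𝓞 K), IsVanishing f p →
      ∃ a : 𝓞 K, IsMaximalAt p (f - C a)) :
    ∃ (S : Set (𝓞 K)) (δ : ℝ), 0 < δ ∧ HasDensity S δ ∧ ∀ a ∈ S, IsDynMonogenic f a := by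
  have hd : 0 < f.natDegree := by
    obtain ⟨a, -, ha⟩ := (hasDensity_univ.sdiff_zero hZ).nonempty one_pos
    exact natDegree_pos_of_irreducible_sub_C (hirr a ha 1 le_rfl)
  have hc : ∀ p : HeightOneSpectrum (𝓞 K), ∃ c : 𝓞 K,
      (IsVanishing f p → IsMaximalAt p (f - C c)) ∧
      (¬ IsVanishing f p → ∀ b : 𝓞 K, (b : K) ∈ postcriticalSet f → b - c ∉ p.asIdeal ^ 2) := by
    intro p
    by_cases hp : IsVanishing f p
    · obtain ⟨a, ha⟩ := h2 p hp
      exact ⟨a, fun _ => ha, fun h => absurd hp h⟩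
    · obtain ⟨c, hc⟩ := h1 p hp
      obtain ⟨c, rfl⟩ := Ideal.Quotient.mk_surjective c
      exact ⟨c, fun h => absurd h hp, fun _ b hb hbc => hc b hb (Ideal.Quotient.eq.mpr hbc)⟩
  choose c hcV hcN using hc
  have hΩ := finite_setOf_mem_postcriticalSet hd hpcf
  obtain ⟨S, δ, hδ, hS, hSa⟩ := exists_hasDensity_sieve hΩ.toFinset (finite_setOf_isVanishing hd) c
    fun v hv ω hω => hcN v hv ω (hΩ.mem_toFinset.mp hω)
  refine ⟨S \ Z, δ, hδ, hS.sdiff_zero hZ, fun a ⟨haS, haZ⟩ =>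
    isDynMonogenic_of_forall_notMem_sq hlead hd (hirr a haZ) fun p M hMmax hM n => ?_⟩
  obtain ⟨haV, haN⟩ := hSa a haS
  by_cases hp : IsVanishing f p
  · exact iter_sub_C_notMem_sq_of_isVanishing hlead hd hp (hcV p hp) (haV p hp) hM n
  · exact iter_sub_C_notMem_sq_of_not_isVanishing hlead hd hpcf hrat hp
      (fun b hb => haN p hp b (hΩ.mem_toFinset.mpr hb)) hM (n + 1)

/-- Take `M` above `p` containing the minimal polynomial of `θ`, where `b = fⁿ(θ)`. Its square
divides `fⁿ - b`, so `b - a ∈ p ^ 2` would put `fⁿ - a` into `M ^ 2`. The argument applies to every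
prime, vanishing or not. -/
theorem IsDynMonogenic.sub_notMem_sq {a b : 𝓞 K} (ha : IsDynMonogenic f a)
    (hlead : IsUnit f.leadingCoeff) (hd : 0 < f.natDegree) (hpcf : IsPCF f)
    (hb : (b : K) ∈ postcriticalSet f) (p : HeightOneSpectrum (𝓞 K)) :
    b - a ∉ p.asIdeal ^ 2 := by
  intro hba
  obtain ⟨θ, hθ, n, hn, hbn⟩ := hb
  obtain ⟨m, rfl⟩ : ∃ m, n = m + 1 := ⟨n - 1, by omega⟩
  have hint := hθ.isIntegral hlead hd hpcf
  have hmax : p.asIdeal.IsMaximal := p.isMaximal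
  have hmon := minpoly.monic hint
  have hne : p.asIdeal.map C ⊔ Ideal.span {minpoly (𝓞 K) θ} ≠ ⊤ := by
    intro htop
    have h1 : (1 : (𝓞 K)[X]) ∈ p.asIdeal.map C ⊔ Ideal.span {minpoly (𝓞 K) θ} :=
      htop ▸ Submodule.mem_top
    obtain ⟨z, hz, y, hy, hzy⟩ := Submodule.mem_sup.mp h1
    obtain ⟨w, rfl⟩ := Ideal.mem_span_singleton.mp hy
    have h2 := congrArg (Polynomial.map (Ideal.Quotient.mk p.asIdeal)) hzy
    rw [Polynomial.map_add, map_mk_eq_zero_of_mem_map_C hz, zero_add, Polynomial.map_mul,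
      Polynomial.map_one] at h2
    have h3 := (hmon.map (Ideal.Quotient.mk p.asIdeal)).eq_one_of_isUnit (.of_mul_eq_one _ h2)
    have h4 := congrArg natDegree h3
    rw [hmon.natDegree_map, natDegree_one] at h4
    exact (minpoly.natDegree_pos hint).ne' h4
  obtain ⟨M, hM, hle⟩ := Ideal.exists_le_maximal _ hne
  have hpM : p.asIdeal.map C ≤ M := le_sup_left.trans hle
  have hθM : minpoly (𝓞 K) θ ∈ M :=
    hle (Ideal.mem_sup_right (Ideal.mem_span_singleton_self _))
  have h1 : iter f (m + 1) - C b ∈ M ^ 2 :=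
    Ideal.mem_of_dvd _ (hθ.sq_minpoly_dvd hint hbn) (Ideal.pow_mem_pow hθM 2)
  have h2 : C (b - a) ∈ M ^ 2 := by
    have := Ideal.mem_map_of_mem (C : 𝓞 K →+* (𝓞 K)[X]) hba
    rw [Ideal.map_pow] at this
    exact Ideal.pow_right_mono hpM 2 this
  have h3 : iter f (m + 1) - C a ∈ M ^ 2 := by
    have := Ideal.add_mem _ h1 h2
    rwa [C_sub, sub_add_sub_cancel] at this
  exact ((ha _ hn).isMaximalAt p).notMem_sq (isUnit_leadingCoeff_iter_sub_C hlead hd _ a) hpM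
    (Ideal.pow_le_self two_ne_zero h3) h3

end Global

end DynMono

theorem lemma3p1 {K : Type*} [Field K] [NumberField K] (f : (𝓞 K)[X])
    (hlead : IsUnit f.leadingCoeff)
    (hpcf : DynMono.IsPCF f)
    (hrat : DynMono.HasRationalCriticalValues f)
    (hirr : ∃ Z : Set (𝓞 K), DynMono.HasDensity Z 0 ∧
      ∀ a : 𝓞 K, a ∉ Z → DynMono.IsDynIrreducible f a)
    (hexc : ¬ ∃ p : HeightOneSpectrum (𝓞 K),
      ¬ DynMono.IsVanishing f p ∧ DynMono.IsExceptional f p) :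
    ((∀ p : HeightOneSpectrum (𝓞 K), ¬ DynMono.IsVanishing f p →
        ∃ c : 𝓞 K ⧸ p.asIdeal ^ 2, ∀ b : 𝓞 K, (b : K) ∈ DynMono.postcriticalSet f →
          Ideal.Quotient.mk (p.asIdeal ^ 2) b ≠ c) ∧
      (∀ p : HeightOneSpectrum (𝓞 K), DynMono.IsVanishing f p →
        ∃ a : 𝓞 K, DynMono.IsMaximalAt p (f - C a))) ↔
    ∃ (S : Set (𝓞 K)) (δ : ℝ), 0 < δ ∧ DynMono.HasDensity S δ ∧
      ∀ a ∈ S, DynMono.IsDynMonogenic f a := by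
  constructor
  · rintro ⟨h1, h2⟩
    obtain ⟨Z, hZ, hirr⟩ := hirr
    exact DynMono.exists_hasDensity_isDynMonogenic hlead hpcf hrat hZ hirr h1 h2
  · rintro ⟨S, δ, hδ, hS, hSa⟩
    obtain ⟨a, haS⟩ := hS.nonempty hδ
    have ha := hSa a haS
    have hd := DynMono.natDegree_pos_of_irreducible_sub_C (ha 1 le_rfl).1
    -- One `a ∈ S` serves all primes: its own class modulo `p ^ 2` is free of `Ω`, and `f - a` is
    -- `p`-maximal by the case `n = 1`.
    refine ⟨fun p _ => ⟨Ideal.Quotient.mk _ a, fun b hb hba =>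
      ha.sub_notMem_sq hlead hd hpcf hb p (Ideal.Quotient.eq.mp hba)⟩, fun p _ => ⟨a, ?_⟩⟩
    have := (ha 1 le_rfl).isMaximalAt p
    rwa [DynMono.iter_one] at this
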